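/- Let $\alpha>0$ be a constant. For each $n$ let $H=H_n$ be an $m_n\times n$ random matrix with i.i.d. standard normal entries, where $m_n=\alpha n$; more generally, $(m_n)$ may be any sequence of natural numbers with $m_n/n\to\alpha$ (for instance $m_n=\lfloor\alpha n\rfloor$). Put $$\xi_n=\min_{x\in\{-1/\sqrt n,\,1/\sqrt n\}^n}\|Hx\|_2 .$$ For $c\ge 0$ let $$\widehat\gamma(c)=\frac{2c-\sqrt{4c^2+16\alpha}}{8},\qquad f_\alpha(c)=\frac1c\log\Bigl(\operatorname{erfc}\Bigl(-\frac{c}{\sqrt2}\Bigr)\Bigr)+\widehat\gamma(c)-\frac{\alpha}{2c}\log\Bigl(1-\frac{c}{2\widehat\gamma(c)}\Bigr),$$ where $\operatorname{erfc}(x)=\frac{2}{\sqrt\pi}\int_x^\infty e^{-t^2}\,dt$ and $f_\alpha(0)$ is the limit $\sqrt{2/\pi}-\sqrt\alpha$ of $f_\alpha(c)$ as $c\downarrow0$. Then the minimum of $f_\alpha$ over $c\ge0$ is attained; let $$\xi^{(l)}=\xi^{(l)}(\alpha)=-\min_{c\ge0}f_\alpha(c).$$ 1. $\xi_n$ is integrable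 for every $n$, and $E\xi_n/\sqrt n\ge\xi^{(l)}$ asymptotically as $n\to\infty$: for every $\varepsilon>0$, for all sufficiently large $n$, $$\frac{E\xi_n}{\sqrt n}\ \ge\ \xi^{(l)}-\varepsilon ,\qquad\text{that is, } \liminf_{n\to\infty}\frac{E\xi_n}{\sqrt n}\ge\xi^{(l)}.$$ 2. For every $\varepsilon>0$, $\lim_{n\to\infty}P\bigl(\xi_n/\sqrt n\ge\xi^{(l)}-\varepsilon\bigr)=1$. Moreover $$\lim_{n\to\infty}P\bigl(\xi_n\ge\xi^{(l)}\bigr)=1\quad\text{and}\quad\lim_{n\to\infty}P\bigl(\xi_n^2\ge(\xi^{(l)})^2\bigr)=1 .$$ 3. If $\alpha=1$, then $\xi^{(l)}=0.32016$ to five decimal places, i.e. $|\xi^{(l)}-0.32016|<5\cdot10^{-6}$, and $E\xi_n/\sqrt n\ge 0.32016$ for all sufficiently large $n$. -/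

import Mathlib

open Filter Topology MeasureTheory ProbabilityTheory

namespace Hopfield

noncomputable section

/-- The complementary error function `erfc x = (2 / √π) ∫_x^∞ exp (-t²) dt`. -/
def erfc (x : ℝ) : ℝ :=
  2 / Real.sqrt Real.pi * ∫ t in Set.Ioi x, Real.exp (-t ^ 2)

/-- The set `{-1/√n, 1/√n}ⁿ`. -/
def signCube (n : ℕ) : Set (Fin n → ℝ) :=
  {x | ∀ j, x j = -(1 / Real.sqrt n) ∨ x j = 1 / Real.sqrt n}

/-- The minimum of the Euclidean norm `‖A x‖₂` over `x ∈ {-1/√n, 1/√n}ⁿ`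
(the set is finite and nonempty, so the infimum is a minimum). -/
def xi {m n : ℕ} (A : Matrix (Fin m) (Fin n) ℝ) : ℝ :=
  sInf ((fun x : Fin n → ℝ => ‖WithLp.toLp 2 (A.mulVec x)‖) '' signCube n)

/-- The negative number `(2 c - √(4 c² + 16 α)) / 8`. -/
def gammaHat (α c : ℝ) : ℝ :=
  (2 * c - Real.sqrt (4 * c ^ 2 + 16 * α)) / 8

/-- The function of `c ≥ 0` that is minimized. The formula has the form `0/0` at `c = 0`;
there the function takes the limit of the formula as `c` decreases to `0`, which is
`√(2/π) - √α`. -/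
def objective (α c : ℝ) : ℝ :=
  if c = 0 then Real.sqrt (2 / Real.pi) - Real.sqrt α
  else 1 / c * Real.log (erfc (-(c / Real.sqrt 2))) + gammaHat α c
    - α / (2 * c) * Real.log (1 - c / (2 * gammaHat α c))

/-- The lower bound: minus the minimum of `objective α` over `c ≥ 0`. -/
def xiLower (α : ℝ) : ℝ :=
  -sInf (objective α '' Set.Ici 0)

end

end Hopfield

/-! The minimum is controlled through its Laplace transform. For c > 0, a lifted Gordon comparison
replaces the matrix A by independent Gaussian vectors g and h: up to factors subexponential in n,
exp(c²n/2) · E exp(-c√n ξ) is at most E exp(-c√n ‖g‖) · E exp(c ∑ |hⱼ|), since the minimum of h·x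
over the cube is -∑ |hⱼ| / √n. The h-factor equals (exp(c²/2) erfc(-c/√2))ⁿ, whose Gaussian part
cancels exp(c²n/2). The g-factor has exponential rate `rate α c`. Hence E exp(-c√n ξ) ≤ exp(n c
(`objective α c` + ε)) for large n (`eventually_integral_exp_neg_xi_le`). For a nearly minimizing c
> 0, Jensen's inequality gives the bound on the mean and Markov's inequality the bounds in
probability.

The comparison (`gordon_comparison`) interpolates between A and (g, h) along a rotation, applied to
a smooth function: the norm becomes √(1 + ‖·‖²) and the maximum of exp(-a · energy) becomes an ℓ^β
norm. Gaussian integration by parts leaves only pure second derivatives (`gaussian_comparison`).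
Their comparison (`sum_model₂_le`) reduces to (1 - q)(1 - r) ≥ 0, averaged over pairs of cube
points, where q and r are inner products of vectors of length at most 1. Taking β = n makes the 2ⁿ
terms of the soft maximum cost only a factor 2.

The rate has two variational lower bounds: over Gaussian multipliers b (`le_rate`), which bound the
moment of ‖g‖, and over affine functions of c (`affine_le_rate`), which show that the objective is
asymptotically nonnegative at infinity. Since the objective is continuous and negative somewhere,
its minimum is attained.

For α = 1 a rational point near the minimizer gives the lower bound on `xiLower 1`. The upper bound
needs the objective on all of (0, ∞): concave minorants on four intervals up to 23/10, and a convex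
minorant beyond. -/

namespace Hopfield

/-! ### Gaussian measure on a finite product and integration by parts -/

/-- The standard Gaussian measure on `ι → ℝ`. -/
noncomputable def stdGauss (ι : Type*) [Fintype ι] : Measure (ι → ℝ) :=
  Measure.pi fun _ => gaussianReal 0 1

/-- The density of the standard Gaussian measure on `ι → ℝ`. -/
noncomputable def stdDensity {ι : Type*} [Fintype ι] (z : ι → ℝ) : ℝ :=
  ∏ i, gaussianPDFReal 0 1 (z i)

section

variable {ι : Type*} [Fintype ι]

instance : IsProbabilityMeasure (stdGauss ι) := by
  unfold stdGauss; infer_instance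

lemma stdDensity_nonneg (z : ι → ℝ) : 0 ≤ stdDensity z :=
  Finset.prod_nonneg fun _ _ => gaussianPDFReal_nonneg _ _ _

lemma stdDensity_eq (z : ι → ℝ) :
    stdDensity z = (√(2 * Real.pi))⁻¹ ^ Fintype.card ι * Real.exp (-(∑ i, z i ^ 2) / 2) := by
  simp only [stdDensity, gaussianPDFReal, NNReal.coe_one, mul_one, sub_zero,
    Finset.prod_mul_distrib, Finset.prod_const, Finset.card_univ, ← Real.exp_sum]
  congr 2
  rw [← Finset.sum_div, Finset.sum_neg_distrib]

lemma measurable_stdDensity : Measurable (stdDensity (ι := ι)) := by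
  unfold stdDensity
  exact Finset.measurable_prod _ fun i _ =>
    (measurable_gaussianPDFReal 0 1).comp (measurable_pi_apply i)

/-- Passing to Lebesgue measure makes integration by parts along coordinate lines available. -/
lemma stdGauss_eq_withDensity :
    stdGauss ι = volume.withDensity fun z => ENNReal.ofReal (stdDensity z) := by
  unfold stdGauss
  refine Measure.pi_eq fun s hs => ?_
  rw [withDensity_apply _ (MeasurableSet.univ_pi hs), volume_pi, Measure.restrict_pi_pi]
  have hint (i : ι) : Integrable (gaussianPDFReal 0 1) (volume.restrict (s i)) :=
    (integrable_gaussianPDFReal 0 1).restrict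
  rw [← ofReal_integral_eq_lintegral_ofReal]
  · unfold stdDensity
    rw [integral_fintype_prod_eq_prod (fun _ : ι => gaussianPDFReal 0 1),
      ENNReal.ofReal_prod_of_nonneg]
    · refine Finset.prod_congr rfl fun i _ => ?_
      rw [gaussianReal_apply_eq_integral _ one_ne_zero]
    · exact fun i _ => integral_nonneg fun x => gaussianPDFReal_nonneg _ _ _
  · exact Integrable.fintype_prod_dep (f := fun _ : ι => gaussianPDFReal 0 1) hint
  · exact ae_of_all _ stdDensity_nonneg

lemma integral_stdGauss (f : (ι → ℝ) → ℝ) :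
    ∫ z, f z ∂(stdGauss ι) = ∫ z, stdDensity z * f z := by
  rw [stdGauss_eq_withDensity, integral_withDensity_eq_integral_toReal_smul
    measurable_stdDensity.ennreal_ofReal (ae_of_all _ fun _ => ENNReal.ofReal_lt_top)]
  simp [ENNReal.toReal_ofReal (stdDensity_nonneg _)]

lemma integrable_stdGauss_iff (f : (ι → ℝ) → ℝ) :
    Integrable f (stdGauss ι) ↔ Integrable fun z => stdDensity z * f z := by
  rw [stdGauss_eq_withDensity, integrable_withDensity_iff_integrable_smul'
    measurable_stdDensity.ennreal_ofReal (ae_of_all _ fun _ => ENNReal.ofReal_lt_top)]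
  simp [ENNReal.toReal_ofReal (stdDensity_nonneg _)]

/-- The dominating functions for the comparison argument are multiples of exp(K ‖z‖₁), which factors
over the coordinates. -/
lemma integrable_exp_mul_sum_abs (K : ℝ) :
    Integrable (fun z : ι → ℝ => Real.exp (K * ∑ i, |z i|)) (stdGauss ι) := by
  have h1 (t : ℝ) : Integrable (fun x => Real.exp (t * x)) (gaussianReal 0 1) :=
    integrable_exp_mul_gaussianReal t
  have h (i : ι) : Integrable (fun x : ℝ => Real.exp (K * |x|)) (gaussianReal 0 1) :=
    integrable_exp_mul_abs (h1 K) (by simpa using h1 (-K))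
  have := Integrable.fintype_prod_dep (f := fun (_ : ι) (x : ℝ) => Real.exp (K * |x|)) h
  simpa only [stdGauss, Finset.mul_sum, Real.exp_sum] using this

/-- `f` is bounded by `C exp (K ‖z‖₁)`. -/
def ExpBound (C K : ℝ) (f : (ι → ℝ) → ℝ) : Prop :=
  ∀ z, |f z| ≤ C * Real.exp (K * ∑ i, |z i|)

lemma ExpBound.integrable {C K : ℝ} {f : (ι → ℝ) → ℝ} (h : ExpBound C K f)
    (hf : AEStronglyMeasurable f (stdGauss ι)) : Integrable f (stdGauss ι) :=
  ((integrable_exp_mul_sum_abs K).const_mul C).mono' hf (ae_of_all _ h)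

lemma abs_le_exp_sum_abs (i : ι) (z : ι → ℝ) : |z i| ≤ Real.exp (∑ j, |z j|) := by
  have h1 : |z i| ≤ ∑ j, |z j| :=
    Finset.single_le_sum (f := fun j => |z j|) (fun _ _ => abs_nonneg _) (Finset.mem_univ i)
  linarith [Real.add_one_le_exp (∑ j, |z j|)]

lemma ExpBound.coord_mul {C K : ℝ} {f : (ι → ℝ) → ℝ} (h : ExpBound C K f) (i : ι) :
    ExpBound C (K + 1) fun z => z i * f z := by
  intro z
  calc |z i * f z| = |z i| * |f z| := abs_mul _ _
    _ ≤ Real.exp (∑ j, |z j|) * (C * Real.exp (K * ∑ j, |z j|)) :=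
        mul_le_mul (abs_le_exp_sum_abs i z) (h z) (abs_nonneg _) (Real.exp_pos _).le
    _ = C * Real.exp ((K + 1) * ∑ j, |z j|) := by
        rw [add_mul, one_mul, Real.exp_add]; ring

lemma ExpBound.nonneg {C K : ℝ} {f : (ι → ℝ) → ℝ} (h : ExpBound C K f) : 0 ≤ C := by
  have := (abs_nonneg _).trans (h 0)
  simpa using this

lemma ExpBound.comp_mul {C K : ℝ} (hK : 0 ≤ K) {f : (ι → ℝ) → ℝ} (h : ExpBound C K f)
    {w : ι → ℝ} (hw : ∀ i, |w i| ≤ 1) : ExpBound C K fun z => f fun i => w i * z i := by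
  intro z
  refine (h _).trans (mul_le_mul_of_nonneg_left (Real.exp_le_exp.2
    (mul_le_mul_of_nonneg_left (Finset.sum_le_sum fun i _ => ?_) hK)) h.nonneg)
  rw [abs_mul]
  exact mul_le_of_le_one_left (abs_nonneg _) (hw i)

variable [DecidableEq ι]

lemma hasLineDerivAt_stdDensity (z : ι → ℝ) (i : ι) :
    HasLineDerivAt ℝ stdDensity (-(z i * stdDensity z)) z (Pi.single i 1) := by
  unfold HasLineDerivAt
  simp only [stdDensity_eq]
  have h (j : ι) : HasDerivAt (fun t : ℝ => (z + t • (Pi.single i 1 : ι → ℝ)) j ^ 2)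
      (2 * z j * (Pi.single i 1 : ι → ℝ) j) 0 := by
    have := (((hasDerivAt_id (0 : ℝ)).mul_const ((Pi.single i 1 : ι → ℝ) j)).const_add
      (z j)).fun_pow 2
    simpa using this
  have hs := HasDerivAt.fun_sum (u := Finset.univ) fun j _ => h j
  have := (((hs.neg).div_const 2).exp).const_mul ((√(2 * Real.pi))⁻¹ ^ Fintype.card ι)
  refine this.congr_deriv ?_
  simp [Pi.single_apply]
  ring

/-- Gaussian integration by parts. -/
lemma integral_coord_mul {C K : ℝ} {f f' : (ι → ℝ) → ℝ} (i : ι)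
    (hf : Continuous f) (hf' : Continuous f') (hb : ExpBound C K f) (hb' : ExpBound C K f')
    (hd : ∀ z, HasLineDerivAt ℝ f (f' z) z (Pi.single i 1)) :
    ∫ z, z i * f z ∂(stdGauss ι) = ∫ z, f' z ∂(stdGauss ι) := by
  have i1 := (integrable_stdGauss_iff _).1 (hb.integrable hf.aestronglyMeasurable)
  have i2 := (integrable_stdGauss_iff _).1 (hb'.integrable hf'.aestronglyMeasurable)
  have i3 := (integrable_stdGauss_iff _).1 ((hb.coord_mul i).integrable
    ((continuous_apply i).mul hf).aestronglyMeasurable)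
  -- The derivative of the density along coordinate i is -zᵢ times the density, so moving the
  -- derivative off f produces the factor zᵢ.
  have := integral_bilinear_hasLineDerivAt_right_eq_neg_left_of_integrable
    (μ := (volume : Measure (ι → ℝ))) (f := f) (f' := f') (g := stdDensity)
    (g' := fun z => -(z i * stdDensity z)) (v := Pi.single i 1) (B := ContinuousLinearMap.mul ℝ ℝ)
    (by simpa [mul_comm] using i2)
    (by refine i3.neg.congr (ae_of_all _ fun z => ?_); simp; ring)
    (by simpa [mul_comm] using i1) (fun x _ => hd x)
    (fun x _ => hasLineDerivAt_stdDensity x i)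
  simp only [ContinuousLinearMap.mul_apply', mul_neg, integral_neg, neg_inj] at this
  rw [integral_stdGauss, integral_stdGauss]
  convert this using 3 <;> ring

end

/-! ### Interpolation between two groups of Gaussian coordinates -/

section

variable {ι : Type*}

/-- The scaling factors `sin θ` (on coordinates marked `true`) and `cos θ` (on the others). -/
noncomputable def rot (b : ι → Bool) (θ : ℝ) (i : ι) : ℝ :=
  if b i then Real.sin θ else Real.cos θ

lemma abs_rot_le (b : ι → Bool) (θ : ℝ) (i : ι) : |rot b θ i| ≤ 1 := by
  unfold rot
  split_ifs
  · exact Real.abs_sin_le_one θ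
  · exact Real.abs_cos_le_one θ

/-- The derivative of `rot` in the angle. -/
noncomputable def rotDeriv (b : ι → Bool) (θ : ℝ) (i : ι) : ℝ :=
  if b i then Real.cos θ else -Real.sin θ

lemma hasDerivAt_rot (b : ι → Bool) (θ : ℝ) (i : ι) :
    HasDerivAt (fun t => rot b t i) (rotDeriv b θ i) θ := by
  unfold rot rotDeriv
  split_ifs
  · exact Real.hasDerivAt_sin θ
  · exact Real.hasDerivAt_cos θ

lemma abs_rotDeriv_le (b : ι → Bool) (θ : ℝ) (i : ι) : |rotDeriv b θ i| ≤ 1 := by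
  unfold rotDeriv
  split_ifs
  · exact Real.abs_cos_le_one θ
  · rw [abs_neg]; exact Real.abs_sin_le_one θ

variable [Fintype ι] [DecidableEq ι]

lemma fderiv_apply_eq_sum {F : (ι → ℝ) → ℝ} {d : ι → (ι → ℝ) → ℝ} (hF : Differentiable ℝ F)
    (hd : ∀ i z, HasLineDerivAt ℝ F (d i z) z (Pi.single i 1)) (z v : ι → ℝ) :
    fderiv ℝ F z v = ∑ i, v i * d i z := by
  conv_lhs => rw [pi_eq_sum_univ' v]
  rw [map_sum]
  refine Finset.sum_congr rfl fun i _ => ?_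
  rw [map_smul, smul_eq_mul, ← (hd i z).lineDeriv, (hF z).lineDeriv_eq_fderiv]

variable {F : (ι → ℝ) → ℝ} {d dd : ι → (ι → ℝ) → ℝ} {C K : ℝ}

/-- Differentiating under the integral gives terms zᵢ ∂ᵢF; integrating by parts in zᵢ trades zᵢ for
another derivative and a factor `rot b θ i`. The coordinates being independent, no mixed derivatives
appear. -/
lemma hasDerivAt_integral_rot (b : ι → Bool) (hK : 0 ≤ K) (hF : Differentiable ℝ F)
    (hd : ∀ i z, HasLineDerivAt ℝ F (d i z) z (Pi.single i 1))
    (hdd : ∀ i z, HasLineDerivAt ℝ (d i) (dd i z) z (Pi.single i 1))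
    (hdc : ∀ i, Continuous (d i)) (hddc : ∀ i, Continuous (dd i))
    (bF : ExpBound C K F) (bd : ∀ i, ExpBound C K (d i)) (bdd : ∀ i, ExpBound C K (dd i))
    (θ : ℝ) :
    HasDerivAt (fun θ => ∫ z, F (fun i => rot b θ i * z i) ∂(stdGauss ι))
      (∑ i, rotDeriv b θ i * rot b θ i *
        ∫ z, dd i (fun j => rot b θ j * z j) ∂(stdGauss ι)) θ := by
  have hcont (t : ℝ) : Continuous fun z : ι → ℝ => fun i => rot b t i * z i := by fun_prop
  have hcd (i : ι) : Continuous fun z : ι → ℝ => d i fun j => rot b θ j * z j :=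
    (hdc i).comp (hcont θ)
  have hb1 (t : ℝ) (i : ι) :
      ExpBound C (K + 1) fun z => z i * d i fun j => rot b t j * z j :=
    ((bd i).comp_mul hK (abs_rot_le b t)).coord_mul i
  have key := hasDerivAt_integral_of_dominated_loc_of_deriv_le (μ := stdGauss ι)
    (F := fun t z => F fun i => rot b t i * z i)
    (F' := fun t z => ∑ i, rotDeriv b t i * (z i * d i fun j => rot b t j * z j))
    (bound := fun z => ∑ _i : ι, C * Real.exp ((K + 1) * ∑ i, |z i|)) (x₀ := θ) (s := Set.univ)
    Filter.univ_mem
    (Eventually.of_forall fun t => (hF.continuous.comp (hcont t)).aestronglyMeasurable)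
    ((bF.comp_mul hK (abs_rot_le b θ)).integrable
      (hF.continuous.comp (hcont θ)).aestronglyMeasurable)
    (Continuous.aestronglyMeasurable (continuous_finsetSum _ fun i _ =>
      continuous_const.mul ((continuous_apply i).mul (hcd i))))
    (ae_of_all _ fun z t _ => by
      refine (norm_sum_le _ _).trans (Finset.sum_le_sum fun i _ => ?_)
      rw [norm_mul]
      exact (mul_le_of_le_one_left (norm_nonneg _) (abs_rotDeriv_le b t i)).trans (hb1 t i z))
    (integrable_finsetSum _ fun i _ => (integrable_exp_mul_sum_abs (K + 1)).const_mul C)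
    (ae_of_all _ fun z t _ => by
      have h1 : HasDerivAt (fun t => fun i => rot b t i * z i)
          (fun i => rotDeriv b t i * z i) t :=
        hasDerivAt_pi.2 fun i => (hasDerivAt_rot b t i).mul_const (z i)
      have h2 := (hF (fun i => rot b t i * z i)).hasFDerivAt.comp_hasDerivAt t h1
      rw [fderiv_apply_eq_sum hF hd] at h2
      simpa [mul_assoc, Function.comp_def] using h2)
  refine key.2.congr_deriv ?_
  rw [integral_finsetSum]
  · refine Finset.sum_congr rfl fun i _ => ?_
    have hk : ∫ z, z i * d i (fun j => rot b θ j * z j) ∂(stdGauss ι) =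
        ∫ z, rot b θ i * dd i (fun j => rot b θ j * z j) ∂(stdGauss ι) := ?_
    · rw [integral_const_mul, hk, integral_const_mul, mul_assoc]
    refine integral_coord_mul (C := C) (K := K) i (hcd i)
      (continuous_const.mul ((hddc i).comp (hcont θ)))
      ((bd i).comp_mul hK (abs_rot_le b θ)) ?_ ?_
    · intro z
      rw [abs_mul]
      exact (mul_le_of_le_one_left (abs_nonneg _) (abs_rot_le b θ i)).trans
        ((bdd i).comp_mul hK (abs_rot_le b θ) z)
    · intro z
      have h1 := hdd i fun j => rot b θ j * z j
      unfold HasLineDerivAt at h1 ⊢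
      have h2 : HasDerivAt (fun t : ℝ => t * rot b θ i) (rot b θ i) 0 := by
        simpa using (hasDerivAt_id (0 : ℝ)).mul_const (rot b θ i)
      have h3 := HasDerivAt.scomp (g₁ := fun t : ℝ =>
        d i ((fun j => rot b θ j * z j) + t • (Pi.single i 1 : ι → ℝ))) (0 : ℝ)
        (by simpa using h1) h2
      rw [smul_eq_mul] at h3
      refine h3.congr_of_eventuallyEq (Eventually.of_forall fun t => ?_)
      simp only [Function.comp]
      congr 1
      ext j
      by_cases hj : j = i
      · subst hj; simp; ring
      · simp [hj]
  · intro i _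
    exact ((hb1 θ i).integrable
      ((continuous_apply i).mul (hcd i)).aestronglyMeasurable).const_mul _

/-- Gaussian comparison by interpolation: if `∑_{b i} ∂ᵢ²F + κ F ≤ ∑_{¬ b i} ∂ᵢ²F`, then
`exp (κ / 2)` times the Gaussian mean of `F` over the coordinates with `b i` is at most the
Gaussian mean of `F` over the other coordinates. -/
theorem gaussian_comparison (b : ι → Bool) (hK : 0 ≤ K) (κ : ℝ) (hF : Differentiable ℝ F)
    (hd : ∀ i z, HasLineDerivAt ℝ F (d i z) z (Pi.single i 1))
    (hdd : ∀ i z, HasLineDerivAt ℝ (d i) (dd i z) z (Pi.single i 1))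
    (hdc : ∀ i, Continuous (d i)) (hddc : ∀ i, Continuous (dd i))
    (bF : ExpBound C K F) (bd : ∀ i, ExpBound C K (d i)) (bdd : ∀ i, ExpBound C K (dd i))
    (h : ∀ z, ∑ i, (if b i then dd i z else 0) + κ * F z ≤ ∑ i, (if b i then 0 else dd i z)) :
    Real.exp (κ / 2) * ∫ z, F (fun i => if b i then z i else 0) ∂(stdGauss ι) ≤
      ∫ z, F (fun i => if b i then 0 else z i) ∂(stdGauss ι) := by
  set Ψ : ℝ → ℝ := fun θ => ∫ z, F (fun i => rot b θ i * z i) ∂(stdGauss ι) with hΨ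
  have hΨ' := hasDerivAt_integral_rot b hK hF hd hdd hdc hddc bF bd bdd
  have hE (θ : ℝ) : HasDerivAt (fun t => Real.exp (κ / 2 * Real.sin t ^ 2))
      (Real.exp (κ / 2 * Real.sin θ ^ 2) * (κ * (Real.sin θ * Real.cos θ))) θ := by
    have := (((Real.hasDerivAt_sin θ).fun_pow 2).const_mul (κ / 2)).exp
    refine this.congr_deriv ?_
    simp
    ring
  have hprod (θ : ℝ) := (hE θ).fun_mul (hΨ' θ)
  -- The two groups enter the derivative with weights sin θ cos θ and -sin θ cos θ. The factor exp(κ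
  -- sin²θ / 2) contributes κ sin θ cos θ, which accounts for the term κ F. The endpoint 0 keeps the
  -- coordinates not marked by b, and π/2 keeps the marked ones.
  have hanti : AntitoneOn (fun θ => Real.exp (κ / 2 * Real.sin θ ^ 2) * Ψ θ)
      (Set.Icc 0 (Real.pi / 2)) := by
    refine antitoneOn_of_deriv_nonpos (convex_Icc _ _)
      (fun θ _ => (hprod θ).continuousAt.continuousWithinAt)
      (fun θ _ => (hprod θ).differentiableAt.differentiableWithinAt) ?_
    intro θ hθ
    rw [interior_Icc] at hθ
    have hs : 0 ≤ Real.sin θ :=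
      Real.sin_nonneg_of_nonneg_of_le_pi hθ.1.le (by linarith [hθ.2, Real.pi_pos])
    have hc : 0 ≤ Real.cos θ := Real.cos_nonneg_of_mem_Icc ⟨by linarith [hθ.1, Real.pi_pos], hθ.2.le⟩
    have hcont : Continuous fun z : ι → ℝ => fun i => rot b θ i * z i := by fun_prop
    have idd (i : ι) : Integrable (fun z => dd i fun j => rot b θ j * z j) (stdGauss ι) :=
      ((bdd i).comp_mul hK (abs_rot_le b θ)).integrable ((hddc i).comp hcont).aestronglyMeasurable
    have iF : Integrable (fun z => F fun j => rot b θ j * z j) (stdGauss ι) :=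
      (bF.comp_mul hK (abs_rot_le b θ)).integrable (hF.continuous.comp hcont).aestronglyMeasurable
    have hsum : ∑ i, rotDeriv b θ i * rot b θ i *
          ∫ z, dd i (fun j => rot b θ j * z j) ∂(stdGauss ι) + κ * (Real.sin θ * Real.cos θ) * Ψ θ
        = Real.sin θ * Real.cos θ * ∫ z, (∑ i, (if b i then dd i fun j => rot b θ j * z j else 0)
          + κ * F (fun j => rot b θ j * z j)
          - ∑ i, (if b i then 0 else dd i fun j => rot b θ j * z j)) ∂(stdGauss ι) := by
      have e1 : Integrable (fun z : ι → ℝ => ∑ i, (if b i then dd i fun j => rot b θ j * z j else 0))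
          (stdGauss ι) := integrable_finsetSum _ fun i _ => by
        by_cases hb : b i
        · simpa [hb] using idd i
        · simp [hb]
      have e2 : Integrable (fun z : ι → ℝ => ∑ i, (if b i then 0 else dd i fun j => rot b θ j * z j))
          (stdGauss ι) := integrable_finsetSum _ fun i _ => by
        by_cases hb : b i
        · simp [hb]
        · simpa [hb] using idd i
      have e3 : Integrable (fun z : ι → ℝ => ∑ i, (if b i then dd i fun j => rot b θ j * z j else 0)
          + κ * F (fun j => rot b θ j * z j)) (stdGauss ι) := e1.add (iF.const_mul κ)
      rw [integral_sub e3 e2, integral_add e1 (iF.const_mul κ),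
        integral_const_mul, integral_finsetSum, integral_finsetSum]
      · have (x y w : ℝ) : Real.sin θ * Real.cos θ * (x + κ * w - y)
            = Real.sin θ * Real.cos θ * (x - y) + κ * (Real.sin θ * Real.cos θ) * w := by ring
        rw [this, ← Finset.sum_sub_distrib, Finset.mul_sum]
        congr 1
        refine Finset.sum_congr rfl fun i _ => ?_
        by_cases hb : b i <;> simp only [hb, rot, rotDeriv, if_true, if_false, integral_zero,
          Bool.false_eq_true] <;> ring
      · intro i _
        by_cases hb : b i
        · simp [hb]
        · simpa [hb] using idd i
      · intro i _
        by_cases hb : b i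
        · simpa [hb] using idd i
        · simp [hb]
    have hle : ∫ z, (∑ i, (if b i then dd i fun j => rot b θ j * z j else 0)
          + κ * F (fun j => rot b θ j * z j)
          - ∑ i, (if b i then 0 else dd i fun j => rot b θ j * z j)) ∂(stdGauss ι) ≤ 0 :=
      integral_nonpos fun z => sub_nonpos.2 (h _)
    have hder := (hprod θ).deriv
    change deriv (fun θ => Real.exp (κ / 2 * Real.sin θ ^ 2) * Ψ θ) θ = _ at hder
    rw [hder]
    have : Real.exp (κ / 2 * Real.sin θ ^ 2) * (κ * (Real.sin θ * Real.cos θ)) * Ψ θ +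
        Real.exp (κ / 2 * Real.sin θ ^ 2) * (∑ i, rotDeriv b θ i * rot b θ i *
          ∫ z, dd i (fun j => rot b θ j * z j) ∂(stdGauss ι)) =
        Real.exp (κ / 2 * Real.sin θ ^ 2) * (∑ i, rotDeriv b θ i * rot b θ i *
          ∫ z, dd i (fun j => rot b θ j * z j) ∂(stdGauss ι)
          + κ * (Real.sin θ * Real.cos θ) * Ψ θ) := by ring
    change Real.exp (κ / 2 * Real.sin θ ^ 2) * (κ * (Real.sin θ * Real.cos θ)) * Ψ θ + _ ≤ 0
    rw [this, hsum]
    exact mul_nonpos_of_nonneg_of_nonpos (Real.exp_pos _).le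
      (mul_nonpos_of_nonneg_of_nonpos (mul_nonneg hs hc) hle)
  have := hanti (Set.left_mem_Icc.2 (by positivity)) (Set.right_mem_Icc.2 (by positivity))
    (by positivity : (0 : ℝ) ≤ Real.pi / 2)
  simpa [hΨ, rot] using this

end

/-! ### Soft maximum and Gibbs weights -/

section SoftMax

variable {σ : Type*} [Fintype σ]

/-- The partition function of the energies `ω`. -/
noncomputable def partition (a β : ℝ) (ω : σ → ℝ) : ℝ := ∑ x, Real.exp (-(a * β * ω x))

/-- A smooth substitute for `max_x exp (-a ω x)`. -/
noncomputable def softMax (a β : ℝ) (ω : σ → ℝ) : ℝ := partition a β ω ^ (1 / β)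

/-- The Gibbs weights of the energies `ω`. -/
noncomputable def gibbs (a β : ℝ) (ω : σ → ℝ) (x : σ) : ℝ :=
  Real.exp (-(a * β * ω x)) / partition a β ω

variable {a β : ℝ}

lemma partition_pos [Nonempty σ] (ω : σ → ℝ) : 0 < partition a β ω :=
  Finset.sum_pos (fun _ _ => Real.exp_pos _) Finset.univ_nonempty

lemma softMax_pos [Nonempty σ] (ω : σ → ℝ) : 0 < softMax a β ω :=
  Real.rpow_pos_of_pos (partition_pos ω) _

lemma gibbs_nonneg [Nonempty σ] (ω : σ → ℝ) (x : σ) : 0 ≤ gibbs a β ω x :=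
  div_nonneg (Real.exp_pos _).le (partition_pos ω).le

lemma sum_gibbs [Nonempty σ] (ω : σ → ℝ) : ∑ x, gibbs a β ω x = 1 := by
  simp only [gibbs, ← Finset.sum_div]
  exact div_self (partition_pos ω).ne'

lemma exp_le_softMax [Nonempty σ] (hβ : 0 < β) (ω : σ → ℝ) (x : σ) :
    Real.exp (-(a * ω x)) ≤ softMax a β ω := by
  have h1 : Real.exp (-(a * β * ω x)) ≤ partition a β ω :=
    Finset.single_le_sum (f := fun x => Real.exp (-(a * β * ω x)))
      (fun _ _ => (Real.exp_pos _).le) (Finset.mem_univ x)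
  have h2 := Real.rpow_le_rpow (Real.exp_pos _).le h1 (by positivity : 0 ≤ 1 / β)
  rw [← Real.exp_mul] at h2
  have h3 : -(a * β * ω x) * (1 / β) = -(a * ω x) := by field_simp
  rwa [h3] at h2

lemma hasDerivAt_partition {W : σ → ℝ → ℝ} {w : σ → ℝ} {t : ℝ}
    (h : ∀ x, HasDerivAt (W x) (w x) t) :
    HasDerivAt (fun s => partition a β fun x => W x s)
      (-(a * β) * ∑ x, Real.exp (-(a * β * W x t)) * w x) t := by
  have := HasDerivAt.fun_sum (u := Finset.univ) fun x _ => (((h x).const_mul (a * β)).fun_neg).exp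
  refine this.congr_deriv ?_
  rw [Finset.mul_sum]
  exact Finset.sum_congr rfl fun x _ => by ring

lemma hasDerivAt_softMax [Nonempty σ] (hβ : 0 < β) {W : σ → ℝ → ℝ} {w : σ → ℝ} {t : ℝ}
    (h : ∀ x, HasDerivAt (W x) (w x) t) :
    HasDerivAt (fun s => softMax a β fun x => W x s)
      (-a * softMax a β (fun x => W x t) * ∑ x, gibbs a β (fun x => W x t) x * w x) t := by
  have hp := partition_pos (a := a) (β := β) fun x => W x t
  have := (hasDerivAt_partition (a := a) (β := β) h).rpow_const (p := 1 / β) (Or.inl hp.ne')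
  refine this.congr_deriv ?_
  simp only [softMax, gibbs, Real.rpow_sub_one hp.ne', div_mul_eq_mul_div, ← Finset.sum_div]
  field_simp

lemma hasDerivAt_gibbs [Nonempty σ] {W : σ → ℝ → ℝ} {w : σ → ℝ} {t : ℝ}
    (h : ∀ x, HasDerivAt (W x) (w x) t) (x : σ) :
    HasDerivAt (fun s => gibbs a β (fun x => W x s) x)
      (a * β * gibbs a β (fun x => W x t) x *
        (∑ y, gibbs a β (fun x => W x t) y * w y - w x)) t := by
  have hp := partition_pos (a := a) (β := β) fun x => W x t
  have := ((((h x).const_mul (a * β)).fun_neg).exp).fun_div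
    (hasDerivAt_partition (a := a) (β := β) h) hp.ne'
  refine this.congr_deriv ?_
  simp only [gibbs, div_mul_eq_mul_div, ← Finset.sum_div]
  field_simp
  ring

lemma abs_sum_gibbs_mul_le [Nonempty σ] (ω : σ → ℝ) {w : σ → ℝ} {L : ℝ} (hw : ∀ x, |w x| ≤ L) :
    |∑ x, gibbs a β ω x * w x| ≤ L := by
  calc |∑ x, gibbs a β ω x * w x| ≤ ∑ x, |gibbs a β ω x * w x| := Finset.abs_sum_le_sum_abs _ _
    _ ≤ ∑ x, gibbs a β ω x * L := Finset.sum_le_sum fun x _ => by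
        rw [abs_mul, abs_of_nonneg (gibbs_nonneg ω x)]
        exact mul_le_mul_of_nonneg_left (hw x) (gibbs_nonneg ω x)
    _ = L := by rw [← Finset.sum_mul, sum_gibbs, one_mul]

/-- Common shifts of the energy factor out; this splits one side of the comparison into an integral
over g times an integral over h. -/
lemma softMax_const_add [Nonempty σ] (c : ℝ) (hβ : 0 < β) (ω : σ → ℝ) :
    softMax a β (fun s => c + ω s) = Real.exp (-(a * c)) * softMax a β ω := by
  have h : partition a β (fun s => c + ω s) = Real.exp (-(a * β * c)) * partition a β ω := by
    simp only [partition, Finset.mul_sum, ← Real.exp_add]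
    exact Finset.sum_congr rfl fun s _ => by ring_nf
  rw [softMax, h, Real.mul_rpow (Real.exp_pos _).le (partition_pos ω).le, ← Real.exp_mul, softMax]
  congr 2
  field_simp

end SoftMax

/-! ### Smoothed norm and its derivatives -/

section Energy

variable {ι σ μ : Type*} [Fintype ι] [Fintype σ] [Fintype μ]

/-- The value at `z` of the linear form with coefficients `v`. -/
def lin (v : ι → ℝ) (z : ι → ℝ) : ℝ := ∑ k, v k * z k

/-- The smoothed norm `√(1 + ∑ (vᵢ z)²)` of a vector of linear forms. -/
noncomputable def smoothNorm (v : μ → ι → ℝ) (z : ι → ℝ) : ℝ := √(1 + ∑ i, lin (v i) z ^ 2)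

/-- The smoothed norm plus a linear form. -/
noncomputable def energy (v : μ → ι → ℝ) (u : ι → ℝ) (z : ι → ℝ) : ℝ := smoothNorm v z + lin u z

/-- The partial derivatives of the energy. -/
noncomputable def energy₁ (v : μ → ι → ℝ) (u : ι → ℝ) (k : ι) (z : ι → ℝ) : ℝ :=
  (∑ i, lin (v i) z * v i k) / smoothNorm v z + u k

/-- The pure second partial derivatives of the energy. -/
noncomputable def energy₂ (v : μ → ι → ℝ) (k : ι) (z : ι → ℝ) : ℝ :=
  (∑ i, v i k ^ 2) / smoothNorm v z - (∑ i, lin (v i) z * v i k) ^ 2 / smoothNorm v z ^ 3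

lemma smoothNorm_sq (v : μ → ι → ℝ) (z : ι → ℝ) :
    smoothNorm v z ^ 2 = 1 + ∑ i, lin (v i) z ^ 2 :=
  Real.sq_sqrt (by positivity)

/-- The 1 under the root keeps the norm away from zero, so the energy is smooth everywhere with
bounded first and second partial derivatives. -/
lemma one_le_smoothNorm (v : μ → ι → ℝ) (z : ι → ℝ) : 1 ≤ smoothNorm v z :=
  Real.one_le_sqrt.2 (le_add_of_nonneg_right (by positivity))

lemma abs_lin_le_smoothNorm (v : μ → ι → ℝ) (z : ι → ℝ) (i : μ) :
    |lin (v i) z| ≤ smoothNorm v z := by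
  refine Real.abs_le_sqrt ?_
  have : lin (v i) z ^ 2 ≤ ∑ i, lin (v i) z ^ 2 :=
    Finset.single_le_sum (f := fun i => lin (v i) z ^ 2) (fun _ _ => sq_nonneg _) (Finset.mem_univ i)
  linarith

lemma abs_lin_le {u : ι → ℝ} (hu : ∀ k, |u k| ≤ 1) (z : ι → ℝ) : |lin u z| ≤ ∑ k, |z k| := by
  refine (Finset.abs_sum_le_sum_abs _ _).trans (Finset.sum_le_sum fun k _ => ?_)
  rw [abs_mul]
  exact mul_le_of_le_one_left (abs_nonneg _) (hu k)

lemma abs_sum_lin_mul_le {v : μ → ι → ℝ} (hv : ∀ i k, |v i k| ≤ 1) (k : ι) (z : ι → ℝ) :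
    |∑ i, lin (v i) z * v i k| ≤ Fintype.card μ * smoothNorm v z := by
  refine (Finset.abs_sum_le_sum_abs _ _).trans ?_
  calc ∑ i, |lin (v i) z * v i k| ≤ ∑ _i : μ, smoothNorm v z := Finset.sum_le_sum fun i _ => by
        rw [abs_mul]
        exact (mul_le_of_le_one_right (abs_nonneg _) (hv i k)).trans (abs_lin_le_smoothNorm v z i)
    _ = _ := by simp

lemma abs_energy₁_le {v : μ → ι → ℝ} {u : ι → ℝ} (hv : ∀ i k, |v i k| ≤ 1)
    (hu : ∀ k, |u k| ≤ 1) (k : ι) (z : ι → ℝ) : |energy₁ v u k z| ≤ Fintype.card μ + 1 := by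
  have h1 := one_le_smoothNorm v z
  refine (abs_add_le _ _).trans (add_le_add ?_ (hu k))
  rw [abs_div, abs_of_pos (by linarith : 0 < smoothNorm v z), div_le_iff₀ (by linarith)]
  exact abs_sum_lin_mul_le hv k z

lemma abs_energy₂_le {v : μ → ι → ℝ} (hv : ∀ i k, |v i k| ≤ 1) (k : ι) (z : ι → ℝ) :
    |energy₂ v k z| ≤ Fintype.card μ + Fintype.card μ ^ 2 := by
  have h1 := one_le_smoothNorm v z
  have h0 : 0 < smoothNorm v z := by linarith
  refine (abs_sub _ _).trans (add_le_add ?_ ?_)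
  · rw [abs_div, abs_of_pos h0, abs_of_nonneg (by positivity)]
    refine (div_le_self (by positivity) h1).trans ?_
    calc ∑ i, v i k ^ 2 ≤ ∑ _i : μ, (1 : ℝ) := Finset.sum_le_sum fun i _ => by
          rw [← sq_abs]; exact pow_le_one₀ (abs_nonneg _) (hv i k)
      _ = _ := by simp
  · rw [abs_div, abs_of_pos (pow_pos h0 3), abs_of_nonneg (sq_nonneg _), div_le_iff₀ (by positivity),
      ← sq_abs]
    calc |∑ i, lin (v i) z * v i k| ^ 2 ≤ (Fintype.card μ * smoothNorm v z) ^ 2 :=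
          pow_le_pow_left₀ (abs_nonneg _) (abs_sum_lin_mul_le hv k z) 2
      _ = Fintype.card μ ^ 2 * smoothNorm v z ^ 2 := by ring
      _ ≤ Fintype.card μ ^ 2 * smoothNorm v z ^ 3 :=
          mul_le_mul_of_nonneg_left (pow_le_pow_right₀ h1 (by norm_num)) (by positivity)

lemma continuous_lin (v : ι → ℝ) : Continuous (lin v) := by unfold lin; fun_prop

lemma continuous_smoothNorm (v : μ → ι → ℝ) : Continuous (smoothNorm v) := by
  have := fun i => continuous_lin (v i)
  unfold smoothNorm; fun_prop

lemma continuous_energy (v : μ → ι → ℝ) (u : ι → ℝ) : Continuous (energy v u) :=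
  (continuous_smoothNorm v).add (continuous_lin u)

lemma continuous_energy₁ (v : μ → ι → ℝ) (u : ι → ℝ) (k : ι) : Continuous (energy₁ v u k) := by
  have := fun i => continuous_lin (v i)
  refine Continuous.add (Continuous.div (by fun_prop) (continuous_smoothNorm v) fun z => ?_)
    continuous_const
  linarith [one_le_smoothNorm v z]

lemma continuous_energy₂ (v : μ → ι → ℝ) (k : ι) : Continuous (energy₂ v k) := by
  have := fun i => continuous_lin (v i)
  have h0 (z) : smoothNorm v z ≠ 0 := by linarith [one_le_smoothNorm v z]
  exact Continuous.sub (continuous_const.div (continuous_smoothNorm v) h0)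
    (Continuous.div (by fun_prop) ((continuous_smoothNorm v).pow 3) fun z => pow_ne_zero 3 (h0 z))

lemma differentiable_lin (v : ι → ℝ) : Differentiable ℝ (lin v) := by unfold lin; fun_prop

lemma differentiable_energy (v : μ → ι → ℝ) (u : ι → ℝ) : Differentiable ℝ (energy v u) := by
  have := fun i => differentiable_lin (v i)
  refine Differentiable.add (Differentiable.sqrt (by fun_prop) fun z => ?_) (differentiable_lin u)
  positivity

variable [DecidableEq ι]

lemma hasDerivAt_lin_line (v z : ι → ℝ) (k : ι) (t : ℝ) :
    HasDerivAt (fun t : ℝ => lin v (z + t • (Pi.single k 1 : ι → ℝ))) (v k) t := by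
  have h : (fun t : ℝ => lin v (z + t • (Pi.single k 1 : ι → ℝ))) =
      fun t => lin v z + t * v k := by
    ext t
    simp [lin, mul_add, Finset.sum_add_distrib, Pi.single_apply, mul_comm]
  rw [h]
  simpa using ((hasDerivAt_id t).mul_const (v k)).const_add (lin v z)

lemma hasDerivAt_smoothNorm_line (v : μ → ι → ℝ) (z : ι → ℝ) (k : ι) (t : ℝ) :
    HasDerivAt (fun t : ℝ => smoothNorm v (z + t • (Pi.single k 1 : ι → ℝ)))
      ((∑ i, lin (v i) (z + t • (Pi.single k 1 : ι → ℝ)) * v i k) /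
        smoothNorm v (z + t • (Pi.single k 1 : ι → ℝ))) t := by
  have h1 := HasDerivAt.fun_sum (u := Finset.univ) fun i _ =>
    (hasDerivAt_lin_line (v i) z k t).fun_pow 2
  have h2 := (h1.const_add 1).sqrt (by positivity)
  refine h2.congr_deriv ?_
  unfold smoothNorm
  rw [mul_comm (2 : ℝ), ← div_div, div_right_comm]
  congr 1
  rw [Finset.sum_div]
  exact Finset.sum_congr rfl fun i _ => by simp; ring

lemma hasLineDerivAt_energy (v : μ → ι → ℝ) (u : ι → ℝ) (k : ι) (z : ι → ℝ) :
    HasLineDerivAt ℝ (energy v u) (energy₁ v u k z) z (Pi.single k 1) := by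
  have := (hasDerivAt_smoothNorm_line v z k 0).fun_add (hasDerivAt_lin_line u z k 0)
  simpa [HasLineDerivAt, energy₁, energy] using this

lemma hasLineDerivAt_energy₁ (v : μ → ι → ℝ) (u : ι → ℝ) (k : ι) (z : ι → ℝ) :
    HasLineDerivAt ℝ (energy₁ v u k) (energy₂ v k z) z (Pi.single k 1) := by
  have h0 : smoothNorm v z ≠ 0 := by linarith [one_le_smoothNorm v z]
  have h1 := HasDerivAt.fun_sum (u := Finset.univ) fun i _ =>
    (hasDerivAt_lin_line (v i) z k 0).mul_const (v i k)
  have h2 := (h1.fun_div (hasDerivAt_smoothNorm_line v z k 0) (by simpa using h0)).add_const (u k)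
  refine h2.congr_deriv ?_
  simp only [zero_smul, add_zero, energy₂]
  field_simp

end Energy

/-! ### The interpolated function and its second derivatives -/

section Model

variable {ι σ μ : Type*} [Fintype ι] [Fintype σ] [Fintype μ]

/-- The smooth maximum of `exp (-a · energy)` over a family of energies. -/
noncomputable def model (a β : ℝ) (v : σ → μ → ι → ℝ) (u : σ → ι → ℝ) (z : ι → ℝ) : ℝ :=
  softMax a β fun x => energy (v x) (u x) z

/-- The partial derivatives of `model`. -/
noncomputable def model₁ (a β : ℝ) (v : σ → μ → ι → ℝ) (u : σ → ι → ℝ) (k : ι) (z : ι → ℝ) : ℝ :=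
  -a * model a β v u z *
    ∑ x, gibbs a β (fun x => energy (v x) (u x) z) x * energy₁ (v x) (u x) k z

/-- The pure second partial derivatives of `model`. -/
noncomputable def model₂ (a β : ℝ) (v : σ → μ → ι → ℝ) (u : σ → ι → ℝ) (k : ι) (z : ι → ℝ) : ℝ :=
  model a β v u z *
    (a ^ 2 * (1 - β) *
      (∑ x, gibbs a β (fun x => energy (v x) (u x) z) x * energy₁ (v x) (u x) k z) ^ 2
    + a ^ 2 * β *
      ∑ x, gibbs a β (fun x => energy (v x) (u x) z) x * energy₁ (v x) (u x) k z ^ 2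
    - a * ∑ x, gibbs a β (fun x => energy (v x) (u x) z) x * energy₂ (v x) k z)

variable {a β : ℝ} {v : σ → μ → ι → ℝ} {u : σ → ι → ℝ}

lemma continuous_partition :
    Continuous fun z => partition a β fun x => energy (v x) (u x) z := by
  have := fun x => continuous_energy (v x) (u x)
  unfold partition; fun_prop

variable [Nonempty σ]

lemma continuous_model : Continuous (model a β v u) :=
  continuous_partition.rpow_const fun _ => Or.inl (partition_pos _).ne'

lemma continuous_gibbs (x : σ) :
    Continuous fun z => gibbs a β (fun x => energy (v x) (u x) z) x := by
  have := continuous_energy (v x) (u x)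
  exact Continuous.div (by fun_prop) continuous_partition fun _ => (partition_pos _).ne'

lemma continuous_model₁ (k : ι) : Continuous (model₁ a β v u k) := by
  have := continuous_model (a := a) (β := β) (v := v) (u := u)
  have := continuous_gibbs (a := a) (β := β) (v := v) (u := u)
  have := fun x => continuous_energy₁ (v x) (u x) k
  unfold model₁; fun_prop

lemma continuous_model₂ (k : ι) : Continuous (model₂ a β v u k) := by
  have := continuous_model (a := a) (β := β) (v := v) (u := u)
  have := continuous_gibbs (a := a) (β := β) (v := v) (u := u)
  have := fun x => continuous_energy₁ (v x) (u x) k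
  have := fun x => continuous_energy₂ (v x) k
  unfold model₂; fun_prop

lemma differentiable_model : Differentiable ℝ (model a β v u) := by
  have := fun x => differentiable_energy (v x) (u x)
  intro z
  unfold model softMax partition
  refine DifferentiableAt.rpow_const ?_ (Or.inl (partition_pos fun x => energy (v x) (u x) z).ne')
  fun_prop

/-- The smoothed norm only lowers the function, so the linear form alone determines the growth. This
bound and the next two are crude; they serve only to dominate. -/
lemma model_expBound (ha : 0 ≤ a) (hβ : 0 < β) (hu : ∀ x k, |u x k| ≤ 1) :
    ExpBound ((Fintype.card σ : ℝ) ^ (1 / β)) a (model a β v u) := by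
  intro z
  unfold model
  rw [abs_of_pos (softMax_pos _)]
  have h1 : partition a β (fun x => energy (v x) (u x) z) ≤
      Fintype.card σ * Real.exp (a * β * ∑ k, |z k|) := by
    calc partition a β (fun x => energy (v x) (u x) z)
        ≤ ∑ _x : σ, Real.exp (a * β * ∑ k, |z k|) := Finset.sum_le_sum fun x _ => by
          refine Real.exp_le_exp.2 ?_
          rw [← mul_neg]
          refine mul_le_mul_of_nonneg_left ?_ (by positivity)
          have h2 := (abs_le.1 (abs_lin_le (hu x) z)).1
          have h3 := one_le_smoothNorm (v x) z
          unfold energy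
          linarith
      _ = _ := by simp
  refine (Real.rpow_le_rpow (partition_pos _).le h1 (by positivity)).trans_eq ?_
  rw [Real.mul_rpow (by positivity) (Real.exp_pos _).le, ← Real.exp_mul]
  congr 2
  field_simp

lemma model₁_abs_le (ha : 0 ≤ a) (hv : ∀ x i k, |v x i k| ≤ 1)
    (hu : ∀ x k, |u x k| ≤ 1) (k : ι) (z : ι → ℝ) :
    |model₁ a β v u k z| ≤ a * (Fintype.card μ + 1) * |model a β v u z| := by
  unfold model₁
  rw [abs_mul, abs_mul, abs_neg, abs_of_nonneg ha, mul_right_comm]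
  exact mul_le_mul_of_nonneg_right (mul_le_mul_of_nonneg_left
    (abs_sum_gibbs_mul_le _ fun x => abs_energy₁_le (hv x) (hu x) k z) ha) (abs_nonneg _)

lemma model₂_abs_le (ha : 0 ≤ a) (hv : ∀ x i k, |v x i k| ≤ 1)
    (hu : ∀ x k, |u x k| ≤ 1) (k : ι) (z : ι → ℝ) :
    |model₂ a β v u k z| ≤ (a ^ 2 * |1 - β| * (Fintype.card μ + 1) ^ 2 +
      a ^ 2 * |β| * (Fintype.card μ + 1) ^ 2 + a * (Fintype.card μ + Fintype.card μ ^ 2)) *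
        |model a β v u z| := by
  unfold model₂
  rw [abs_mul, mul_comm]
  refine mul_le_mul_of_nonneg_right ?_ (abs_nonneg _)
  have hE1 := fun x => abs_energy₁_le (hv x) (hu x) k z
  refine (abs_sub _ _).trans (add_le_add ((abs_add_le _ _).trans (add_le_add ?_ ?_)) ?_)
  · rw [abs_mul, abs_mul, abs_of_nonneg (sq_nonneg a), abs_pow (∑ x, _)]
    exact mul_le_mul_of_nonneg_left
      (pow_le_pow_left₀ (abs_nonneg _) (abs_sum_gibbs_mul_le _ hE1) 2) (by positivity)
  · rw [abs_mul, abs_mul, abs_of_nonneg (sq_nonneg a)]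
    refine mul_le_mul_of_nonneg_left (abs_sum_gibbs_mul_le _ fun x => ?_) (by positivity)
    rw [abs_of_nonneg (sq_nonneg _), ← sq_abs]
    exact pow_le_pow_left₀ (abs_nonneg _) (hE1 x) 2
  · rw [abs_mul, abs_of_nonneg ha]
    exact mul_le_mul_of_nonneg_left
      (abs_sum_gibbs_mul_le _ fun x => abs_energy₂_le (hv x) k z) ha

variable [DecidableEq ι]

lemma hasLineDerivAt_model (hβ : 0 < β) (k : ι) (z : ι → ℝ) :
    HasLineDerivAt ℝ (model a β v u) (model₁ a β v u k z) z (Pi.single k 1) := by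
  have := hasDerivAt_softMax (a := a) hβ fun x => hasLineDerivAt_energy (v x) (u x) k z
  simpa [HasLineDerivAt, model, model₁] using this

lemma hasLineDerivAt_model₁ (hβ : 0 < β) (k : ι) (z : ι → ℝ) :
    HasLineDerivAt ℝ (model₁ a β v u k) (model₂ a β v u k z) z (Pi.single k 1) := by
  have hW := fun x => hasLineDerivAt_energy (v x) (u x) k z
  have h1 := hasLineDerivAt_model (a := a) (v := v) (u := u) hβ k z
  have h2 := HasDerivAt.fun_sum (u := Finset.univ) fun x _ =>
    (hasDerivAt_gibbs (a := a) (β := β) hW x).fun_mul (hasLineDerivAt_energy₁ (v x) (u x) k z)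
  have h3 := (HasDerivAt.const_mul (-a) h1).fun_mul h2
  refine h3.congr_deriv ?_
  simp only [zero_smul, add_zero, model₁, model₂]
  set p := gibbs a β fun x => energy (v x) (u x) z
  set M := ∑ x, p x * energy₁ (v x) (u x) k z with hM
  -- Differentiating the Gibbs weights gives minus aβ times the Gibbs variance of the first
  -- derivative; the prefactor later supplies the remaining multiple of M².
  have : ∑ x, (a * β * p x * (M - energy₁ (v x) (u x) k z) * energy₁ (v x) (u x) k z +
      p x * energy₂ (v x) k z) = a * β * M ^ 2 - a * β * ∑ x, p x * energy₁ (v x) (u x) k z ^ 2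
        + ∑ x, p x * energy₂ (v x) k z := by
    rw [Finset.sum_add_distrib]
    congr 1
    have h4 : a * β * M ^ 2 = ∑ x, a * β * M * (p x * energy₁ (v x) (u x) k z) := by
      rw [← Finset.mul_sum, ← hM]; ring
    have h5 : a * β * ∑ x, p x * energy₁ (v x) (u x) k z ^ 2 =
        ∑ x, a * β * (p x * energy₁ (v x) (u x) k z ^ 2) := Finset.mul_sum _ _ _
    rw [h4, h5, ← Finset.sum_sub_distrib]
    exact Finset.sum_congr rfl fun x _ => by ring
  rw [this]
  ring

end Model

/-! ### The pairwise inequality behind the comparison -/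

section Algebra

variable {σ μ ν : Type*} [Fintype σ] [Fintype μ] [Fintype ν]

/-- The square of a mean is a double mean over two independent copies of the index. -/
lemma sum_sq_sum_mul (p : σ → ℝ) (f : σ → μ → ℝ) :
    ∑ i, (∑ x, p x * f x i) ^ 2 = ∑ x, ∑ y, p x * p y * ∑ i, f x i * f y i := by
  have h (i : μ) : (∑ x, p x * f x i) ^ 2 = ∑ x, ∑ y, p x * p y * (f x i * f y i) := by
    rw [sq, Finset.sum_mul_sum]
    exact Finset.sum_congr rfl fun x _ => Finset.sum_congr rfl fun y _ => by ring
  simp only [h, Finset.mul_sum]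
  rw [Finset.sum_comm]
  exact Finset.sum_congr rfl fun x _ => Finset.sum_comm

lemma sum_mul_le_one {f g : μ → ℝ} (hf : ∑ i, f i ^ 2 ≤ 1) (hg : ∑ i, g i ^ 2 ≤ 1) :
    ∑ i, f i * g i ≤ 1 := by
  have : ∑ i, f i * g i ≤ ∑ i, (f i ^ 2 + g i ^ 2) / 2 :=
    Finset.sum_le_sum fun i _ => by nlinarith [sq_nonneg (f i - g i)]
  rw [← Finset.sum_div, Finset.sum_add_distrib] at this
  linarith

/-- For a pair x, y put q = G x · G y and r = X x · X y. Both are at most 1, so (1 - q)(1 - r) ≥ 0,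
that is, q + r ≤ qr + 1; averaging over pairs with weights p x p y gives the claim. -/
lemma sum_sq_mean_le {p : σ → ℝ} (hp : ∀ x, 0 ≤ p x) (hp1 : ∑ x, p x = 1)
    {G : σ → μ → ℝ} {X : σ → ν → ℝ} (hG : ∀ x, ∑ i, G x i ^ 2 ≤ 1) (hX : ∀ x, ∑ j, X x j ^ 2 = 1) :
    ∑ i, (∑ x, p x * G x i) ^ 2 + ∑ j, (∑ x, p x * X x j) ^ 2 ≤
      ∑ k : μ × ν, (∑ x, p x * (G x k.1 * X x k.2)) ^ 2 + 1 := by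
  have h1 : (1 : ℝ) = ∑ x, ∑ y, p x * p y := by
    rw [← Finset.sum_mul_sum, hp1, one_mul]
  have h2 (x y : σ) : ∑ k : μ × ν, G x k.1 * X x k.2 * (G y k.1 * X y k.2) =
      (∑ i, G x i * G y i) * ∑ j, X x j * X y j := by
    rw [Finset.sum_mul_sum, Fintype.sum_prod_type]
    exact Finset.sum_congr rfl fun i _ => Finset.sum_congr rfl fun j _ => by ring
  rw [sum_sq_sum_mul, sum_sq_sum_mul, sum_sq_sum_mul p fun x (k : μ × ν) => G x k.1 * X x k.2]
  simp only [h2]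
  rw [h1]
  rw [← sub_nonneg]
  simp only [← Finset.sum_add_distrib, ← Finset.sum_sub_distrib]
  refine Finset.sum_nonneg fun x _ => Finset.sum_nonneg fun y _ => ?_
  have hq := sum_mul_le_one (hG x) (hG y)
  have hr := sum_mul_le_one (hX x).le (hX y).le
  have := mul_nonneg (mul_nonneg (hp x) (hp y)) (mul_nonneg (sub_nonneg.2 hq) (sub_nonneg.2 hr))
  refine this.trans_eq ?_
  ring

end Algebra

/-! ### Splitting Gaussian integrals over independent blocks -/

section Marginals

variable {κ τ : Type*} [Fintype κ] [Fintype τ]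

lemma integral_stdGauss_sum_mul (f : (κ → ℝ) → ℝ) (g : (τ → ℝ) → ℝ) :
    ∫ z, f (fun i => z (Sum.inl i)) * g (fun i => z (Sum.inr i)) ∂(stdGauss (κ ⊕ τ)) =
      (∫ z, f z ∂(stdGauss κ)) * ∫ z, g z ∂(stdGauss τ) := by
  rw [← integral_prod_mul]
  exact (measurePreserving_sumPiEquivProdPi
    (fun _ : κ ⊕ τ => gaussianReal 0 1)).integral_comp' (fun z => f z.1 * g z.2)

lemma integral_stdGauss_inl (f : (κ → ℝ) → ℝ) :
    ∫ z, f (fun i => z (Sum.inl i)) ∂(stdGauss (κ ⊕ τ)) = ∫ z, f z ∂(stdGauss κ) := by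
  simpa using integral_stdGauss_sum_mul f fun _ : τ → ℝ => 1

lemma integral_stdGauss_inr (g : (τ → ℝ) → ℝ) :
    ∫ z, g (fun i => z (Sum.inr i)) ∂(stdGauss (κ ⊕ τ)) = ∫ z, g z ∂(stdGauss τ) := by
  simpa using integral_stdGauss_sum_mul (fun _ : κ → ℝ => 1) g

end Marginals

/-! ### Lifted Gordon comparison -/

section Bilinear

variable {σ μ ν : Type*}

/-- Coefficients of `z ↦ ∑ⱼ hⱼ xⱼ` for `z = (A, g, h)`. -/
def coefU (x : ν → ℝ) : (μ × ν) ⊕ (μ ⊕ ν) → ℝ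
  | .inl _ => 0
  | .inr (.inl _) => 0
  | .inr (.inr j) => x j

lemma abs_coefU_le {x : ν → ℝ} (hx : ∀ j, |x j| ≤ 1) (k : (μ × ν) ⊕ (μ ⊕ ν)) :
    |coefU x k| ≤ 1 := by
  rcases k with ⟨i', j⟩ | i' | j <;> simp [coefU, hx]

section

variable [Fintype μ]

/-- The gradient of v ↦ √(1 + ‖v‖²) has length at most 1. -/
lemma sum_lin_div_sq_le {ι : Type*} [Fintype ι] (v : μ → ι → ℝ) (z : ι → ℝ) :
    ∑ i, (lin (v i) z / smoothNorm v z) ^ 2 ≤ 1 := by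
  have h1 := one_le_smoothNorm v z
  simp only [div_pow, ← Finset.sum_div]
  rw [div_le_one (by positivity), smoothNorm_sq]
  linarith

variable [Fintype ν]

lemma lin_coefU (x : ν → ℝ) (z : (μ × ν) ⊕ (μ ⊕ ν) → ℝ) :
    lin (coefU x) z = ∑ j, z (.inr (.inr j)) * x j := by
  simp [lin, coefU, Fintype.sum_sum_type, mul_comm]

end

variable [DecidableEq μ]

/-- Coefficients of `z ↦ (∑ⱼ A i j xⱼ) + gᵢ` for `z = (A, g, h)`. -/
def coefV (x : ν → ℝ) (i : μ) : (μ × ν) ⊕ (μ ⊕ ν) → ℝ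
  | .inl k => if i = k.1 then x k.2 else 0
  | .inr (.inl i') => if i = i' then 1 else 0
  | .inr (.inr _) => 0

lemma abs_coefV_le {x : ν → ℝ} (hx : ∀ j, |x j| ≤ 1) (i : μ) (k : (μ × ν) ⊕ (μ ⊕ ν)) :
    |coefV x i k| ≤ 1 := by
  rcases k with ⟨i', j⟩ | i' | j <;> simp only [coefV]
  · split_ifs
    · exact hx j
    · simp
  · split_ifs <;> simp
  · simp

variable [Fintype μ]

variable [Fintype ν]

lemma lin_coefV (x : ν → ℝ) (i : μ) (z : (μ × ν) ⊕ (μ ⊕ ν) → ℝ) :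
    lin (coefV x i) z = ∑ j, z (.inl (i, j)) * x j + z (.inr (.inl i)) := by
  simp [lin, coefV, Fintype.sum_sum_type, Fintype.sum_prod_type, mul_comm]

variable [Fintype σ] [Nonempty σ] {a β : ℝ} {x : σ → ν → ℝ}

/-- Because each x s is a unit vector, the Gibbs means of squared first derivatives and of second
derivatives agree for the A- and g-coordinates, while the h-coordinates add a²β. After subtracting
a², what remains is a²(β - 1) times the gap in `sum_sq_mean_le`, times the model: this is where β ≥
1 is needed. -/
lemma sum_model₂_le (hβ : 1 ≤ β) (hx : ∀ s, ∑ j, x s j ^ 2 = 1)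
    (z : (μ × ν) ⊕ (μ ⊕ ν) → ℝ) :
    ∑ k : μ × ν, model₂ a β (fun s => coefV (μ := μ) (x s)) (fun s => coefU (x s)) (.inl k) z
        + a ^ 2 * model a β (fun s => coefV (μ := μ) (x s)) (fun s => coefU (x s)) z ≤
      ∑ k : μ ⊕ ν, model₂ a β (fun s => coefV (μ := μ) (x s)) (fun s => coefU (x s)) (.inr k) z := by
  set v : σ → μ → (μ × ν) ⊕ (μ ⊕ ν) → ℝ := fun s => coefV (x s) with hv
  set u : σ → (μ × ν) ⊕ (μ ⊕ ν) → ℝ := fun s => coefU (x s) with hu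
  set G : σ → μ → ℝ := fun s i => lin (v s i) z / smoothNorm (v s) z with hG
  set p : σ → ℝ := gibbs a β fun s => energy (v s) (u s) z with hp
  have hp0 (s : σ) : 0 ≤ p s := gibbs_nonneg _ s
  have hp1 : ∑ s, p s = 1 := sum_gibbs _
  have hF : 0 ≤ model a β v u z := (softMax_pos _).le
  -- The derivative in Aᵢⱼ is the product of the derivative in gᵢ and the derivative in hⱼ, which is
  -- the tensor structure the pairwise inequality needs.
  have e1 (s : σ) (k : μ × ν) : energy₁ (v s) (u s) (.inl k) z = G s k.1 * x s k.2 := by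
    simp [energy₁, hv, hu, hG, coefV, coefU, div_mul_eq_mul_div]
  have e2 (s : σ) (i : μ) : energy₁ (v s) (u s) (.inr (.inl i)) z = G s i := by
    simp [energy₁, hv, hu, hG, coefV, coefU]
  have e3 (s : σ) (j : ν) : energy₁ (v s) (u s) (.inr (.inr j)) z = x s j := by
    simp [energy₁, hv, hu, coefV, coefU]
  have f1 (s : σ) (k : μ × ν) : energy₂ (v s) (.inl k) z =
      (1 / smoothNorm (v s) z - lin (v s k.1) z ^ 2 / smoothNorm (v s) z ^ 3) * x s k.2 ^ 2 := by
    simp [energy₂, hv, coefV, ite_pow, mul_pow]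
    ring
  have f2 (s : σ) (i : μ) : energy₂ (v s) (.inr (.inl i)) z =
      1 / smoothNorm (v s) z - lin (v s i) z ^ 2 / smoothNorm (v s) z ^ 3 := by
    simp [energy₂, hv, coefV, ite_pow]
  have f3 (s : σ) (j : ν) : energy₂ (v s) (.inr (.inr j)) z = 0 := by
    simp [energy₂, hv, coefV]
  have prodsum (f : μ → ℝ) (s : σ) : ∑ k : μ × ν, f k.1 * x s k.2 ^ 2 = ∑ i, f i := by
    rw [Fintype.sum_prod_type]
    simp only [← Finset.mul_sum, hx, mul_one]
  have hB : ∑ k : μ × ν, ∑ s, p s * (G s k.1 * x s k.2) ^ 2 = ∑ i, ∑ s, p s * G s i ^ 2 := by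
    refine Finset.sum_comm.trans (.trans (Finset.sum_congr rfl fun s _ => ?_) Finset.sum_comm)
    simp only [← Finset.mul_sum, mul_pow]
    rw [prodsum (fun i => G s i ^ 2) s]
  have hB' : ∑ j, ∑ s, p s * x s j ^ 2 = 1 := by
    rw [Finset.sum_comm]
    simp only [← Finset.mul_sum, hx, mul_one, hp1]
  have hC : ∑ k : μ × ν, ∑ s, p s * ((1 / smoothNorm (v s) z -
        lin (v s k.1) z ^ 2 / smoothNorm (v s) z ^ 3) * x s k.2 ^ 2) =
      ∑ i, ∑ s, p s * (1 / smoothNorm (v s) z - lin (v s i) z ^ 2 / smoothNorm (v s) z ^ 3) := by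
    refine Finset.sum_comm.trans (.trans (Finset.sum_congr rfl fun s _ => ?_) Finset.sum_comm)
    simp only [← Finset.mul_sum]
    rw [prodsum (fun i => 1 / smoothNorm (v s) z - lin (v s i) z ^ 2 / smoothNorm (v s) z ^ 3) s]
  have key := sum_sq_mean_le hp0 hp1 (G := G) (X := x) (fun s => sum_lin_div_sq_le (v s) z) hx
  rw [Fintype.sum_sum_type]
  simp only [model₂, e1, e2, e3, f1, f2, f3, ← hp, ← Finset.mul_sum, Finset.sum_add_distrib,
    Finset.sum_sub_distrib, mul_zero, Finset.sum_const_zero, hB, hB', hC]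
  rw [← sub_nonneg] at key ⊢
  have := mul_nonneg (mul_nonneg hF (mul_nonneg (sq_nonneg a) (sub_nonneg.2 hβ))) key
  refine this.trans_eq ?_
  ring

variable [DecidableEq ν]

/-- The lifted form of Gordon's comparison inequality for a smoothed norm and a smooth maximum. -/
theorem gordon_comparison (ha : 0 ≤ a) (hβ : 1 ≤ β) (hx : ∀ s, ∑ j, x s j ^ 2 = 1) :
    Real.exp (a ^ 2 / 2) *
        ∫ A, softMax a β (fun s => √(1 + ∑ i, (∑ j, A (i, j) * x s j) ^ 2)) ∂(stdGauss (μ × ν)) ≤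
      (∫ g, Real.exp (-(a * √(1 + ∑ i, g i ^ 2))) ∂(stdGauss μ)) *
        ∫ h, softMax a β (fun s => ∑ j, h j * x s j) ∂(stdGauss ν) := by
  have hβ0 : 0 < β := by linarith
  have hx1 (s : σ) (j : ν) : |x s j| ≤ 1 := by
    rw [← sq_le_one_iff_abs_le_one, ← hx s]
    exact Finset.single_le_sum (f := fun j => x s j ^ 2) (fun _ _ => sq_nonneg _) (Finset.mem_univ j)
  set v : σ → μ → (μ × ν) ⊕ (μ ⊕ ν) → ℝ := fun s => coefV (x s) with hv
  set u : σ → (μ × ν) ⊕ (μ ⊕ ν) → ℝ := fun s => coefU (x s) with hu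
  have hv1 (s i k) : |v s i k| ≤ 1 := abs_coefV_le (hx1 s) i k
  have hu1 (s k) : |u s k| ≤ 1 := abs_coefU_le (hx1 s) k
  set C₁ : ℝ := a * (Fintype.card μ + 1)
  set C₂ : ℝ := a ^ 2 * |1 - β| * (Fintype.card μ + 1) ^ 2 +
      a ^ 2 * |β| * (Fintype.card μ + 1) ^ 2 + a * (Fintype.card μ + Fintype.card μ ^ 2)
  have hC₁ : 0 ≤ C₁ := by positivity
  have hC₂ : 0 ≤ C₂ := by positivity
  have bF := model_expBound (v := v) ha hβ0 hu1
  -- The function and both families of derivatives must share one exponential bound, so the three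
  -- constants are summed.
  have lift {f : ((μ × ν) ⊕ (μ ⊕ ν) → ℝ) → ℝ} {c : ℝ} (hc : c ≤ 1 + C₁ + C₂)
      (hf : ∀ z, |f z| ≤ c * |model a β v u z|) :
      ExpBound ((1 + C₁ + C₂) * (Fintype.card σ : ℝ) ^ (1 / β)) a f := fun z => by
    rw [mul_assoc]
    exact (hf z).trans (mul_le_mul hc (bF z) (abs_nonneg _) (by positivity))
  -- The marked coordinates are the entries of A. The constant κ = a² plays the role of the extra
  -- scalar Gaussian in Gordon's lifted inequality.
  have := gaussian_comparison (fun k => k.isLeft) ha (a ^ 2)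
    (differentiable_model (a := a) (β := β) (v := v) (u := u))
    (hasLineDerivAt_model hβ0) (hasLineDerivAt_model₁ hβ0) continuous_model₁ continuous_model₂
    (lift (c := 1) (by linarith) fun z => by rw [one_mul])
    (fun k => lift (by linarith) (model₁_abs_le ha hv1 hu1 k))
    (fun k => lift (by linarith) (model₂_abs_le ha hv1 hu1 k))
    (fun z => by simpa [Fintype.sum_sum_type] using sum_model₂_le (a := a) hβ hx z)
  have hL : ∀ z : (μ × ν) ⊕ (μ ⊕ ν) → ℝ, model a β v u (fun k => if k.isLeft then z k else 0) =
      softMax a β (fun s => √(1 + ∑ i, (∑ j, z (.inl (i, j)) * x s j) ^ 2)) := fun z => by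
    simp [model, energy, smoothNorm, hv, hu, lin_coefV, lin_coefU]
  have hR : ∀ z : (μ × ν) ⊕ (μ ⊕ ν) → ℝ, model a β v u (fun k => if k.isLeft then 0 else z k) =
      Real.exp (-(a * √(1 + ∑ i, z (.inr (.inl i)) ^ 2))) *
        softMax a β (fun s => ∑ j, z (.inr (.inr j)) * x s j) := fun z => by
    rw [← softMax_const_add _ hβ0]
    simp [model, energy, smoothNorm, hv, hu, lin_coefV, lin_coefU]
  simp only [hL, hR] at this
  rw [integral_stdGauss_inl (τ := μ ⊕ ν) fun A : μ × ν → ℝ =>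
    softMax a β (fun s => √(1 + ∑ i, (∑ j, A (i, j) * x s j) ^ 2)),
    integral_stdGauss_inr (κ := μ × ν) fun y : μ ⊕ ν → ℝ =>
      Real.exp (-(a * √(1 + ∑ i, y (.inl i) ^ 2))) *
        softMax a β (fun s => ∑ j, y (.inr j) * x s j),
    integral_stdGauss_sum_mul (fun g : μ → ℝ => Real.exp (-(a * √(1 + ∑ i, g i ^ 2))))
      fun h : ν → ℝ => softMax a β (fun s => ∑ j, h j * x s j)] at this
  exact this

end Bilinear

/-! ### One-dimensional Gaussian integrals -/

/-- Twice the standard normal distribution function, `erfc (-c / √2)`. -/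
noncomputable def cdf2 (c : ℝ) : ℝ := erfc (-(c / √2))

lemma integrable_exp_neg_sq_half : Integrable fun t : ℝ => Real.exp (-t ^ 2 / 2) := by
  have := integrable_exp_neg_mul_sq (b := 1 / 2) (by norm_num)
  refine this.congr (ae_of_all _ fun t => ?_)
  ring_nf

lemma cdf2_eq_integral_Ioi (c : ℝ) :
    cdf2 c = √(2 / Real.pi) * ∫ t in Set.Ioi (-c), Real.exp (-t ^ 2 / 2) := by
  have h2 : (0 : ℝ) < √2 := by positivity
  have h := integral_comp_mul_left_Ioi (fun u => Real.exp (-u ^ 2)) (-c) (inv_pos.2 h2)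
  have h3 : ∀ t : ℝ, Real.exp (-((√2)⁻¹ * t) ^ 2) = Real.exp (-t ^ 2 / 2) := fun t => by
    rw [mul_pow, inv_pow, Real.sq_sqrt (by norm_num)]; ring_nf
  simp only [h3, inv_inv, smul_eq_mul] at h
  rw [h, cdf2, erfc, Real.sqrt_div (by norm_num), show (√2)⁻¹ * -c = -(c / √2) by ring]
  have : √2 * √2 = 2 := Real.mul_self_sqrt (by norm_num)
  field_simp
  linear_combination (-∫ t in Set.Ioi (-(c / √2)), Real.exp (-t ^ 2)) * this

lemma sqrt_two_div_pi_mul : √(2 / Real.pi) * √(Real.pi / 2) = 1 := by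
  rw [← Real.sqrt_mul (by positivity)]
  have := Real.pi_pos
  field_simp
  simp

lemma cdf2_eq (c : ℝ) :
    cdf2 c = 1 + √(2 / Real.pi) * ∫ t in (0)..c, Real.exp (-t ^ 2 / 2) := by
  have hi := integrable_exp_neg_sq_half
  have h0 : ∫ t in Set.Ioi (0 : ℝ), Real.exp (-t ^ 2 / 2) = √(Real.pi / 2) := by
    have := integral_gaussian_Ioi (1 / 2)
    have e : √(Real.pi / (1 / 2)) / 2 = √(Real.pi / 2) := by
      rw [show Real.pi / (1 / 2) = 2 ^ 2 * (Real.pi / 2) by ring, Real.sqrt_mul (by norm_num),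
        Real.sqrt_sq (by norm_num)]
      ring
    rw [← e, ← this]
    congr with t
    ring_nf
  have h1 := intervalIntegral.integral_interval_add_Ioi (a := -c) (b := 0) hi.integrableOn
    hi.integrableOn
  have h2 : ∫ t in (-c)..0, Real.exp (-t ^ 2 / 2) = ∫ t in (0)..c, Real.exp (-t ^ 2 / 2) := by
    have := intervalIntegral.integral_comp_neg (a := 0) (b := c)
      fun t : ℝ => Real.exp (-t ^ 2 / 2)
    simpa using this.symm
  rw [cdf2_eq_integral_Ioi, ← h1, h2, h0, mul_add, sqrt_two_div_pi_mul, add_comm]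

lemma cdf2_zero : cdf2 0 = 1 := by simp [cdf2_eq]

lemma hasDerivAt_cdf2 (c : ℝ) :
    HasDerivAt cdf2 (√(2 / Real.pi) * Real.exp (-c ^ 2 / 2)) c := by
  have hc : Continuous fun t : ℝ => Real.exp (-t ^ 2 / 2) := by fun_prop
  rw [show cdf2 = fun c => 1 + √(2 / Real.pi) * ∫ t in (0)..c, Real.exp (-t ^ 2 / 2) from
    funext cdf2_eq]
  exact ((hc.integral_hasStrictDerivAt 0 c).hasDerivAt.const_mul _).const_add 1

lemma one_le_cdf2 {c : ℝ} (hc : 0 ≤ c) : 1 ≤ cdf2 c := by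
  rw [cdf2_eq]
  have : 0 ≤ ∫ t in (0)..c, Real.exp (-t ^ 2 / 2) :=
    intervalIntegral.integral_nonneg hc fun _ _ => (Real.exp_pos _).le
  have := mul_nonneg (Real.sqrt_nonneg (2 / Real.pi)) this
  linarith

lemma cdf2_le_two {c : ℝ} : cdf2 c ≤ 2 := by
  have hi := integrable_exp_neg_sq_half
  have h1 : ∫ t in Set.Ioi (-c), Real.exp (-t ^ 2 / 2) ≤ ∫ t : ℝ, Real.exp (-t ^ 2 / 2) :=
    setIntegral_le_integral hi (ae_of_all _ fun _ => (Real.exp_pos _).le)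
  have h2 : ∫ t : ℝ, Real.exp (-t ^ 2 / 2) = 2 * √(Real.pi / 2) := by
    have := integral_gaussian (1 / 2)
    rw [show Real.pi / (1 / 2) = 2 ^ 2 * (Real.pi / 2) by ring, Real.sqrt_mul (by norm_num),
        Real.sqrt_sq (by norm_num)] at this
    rw [← this]
    congr with t
    ring_nf
  rw [cdf2_eq_integral_Ioi]
  calc _ ≤ √(2 / Real.pi) * (2 * √(Real.pi / 2)) :=
        mul_le_mul_of_nonneg_left (h1.trans_eq h2) (Real.sqrt_nonneg _)
    _ = 2 := by rw [mul_left_comm, sqrt_two_div_pi_mul, mul_one]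

/-- By symmetry only the half-line matters; completing the square there shifts the Gaussian by c. -/
lemma integral_exp_mul_abs_gaussianReal (c : ℝ) :
    ∫ x, Real.exp (c * |x|) ∂(gaussianReal 0 1) = Real.exp (c ^ 2 / 2) * cdf2 c := by
  rw [integral_gaussianReal_eq_integral_smul one_ne_zero]
  have h1 : ∀ x : ℝ, gaussianPDFReal 0 1 x • Real.exp (c * |x|) =
      (fun y => (√(2 * Real.pi))⁻¹ * Real.exp (c ^ 2 / 2) * Real.exp (-(y - c) ^ 2 / 2)) |x| := by
    intro x
    simp only [gaussianPDFReal, NNReal.coe_one, mul_one, sub_zero, smul_eq_mul, mul_assoc,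
      ← Real.exp_add]
    congr 2
    rw [← sq_abs]
    ring
  simp only [h1]
  rw [integral_comp_abs (f := fun y =>
    (√(2 * Real.pi))⁻¹ * Real.exp (c ^ 2 / 2) * Real.exp (-(y - c) ^ 2 / 2)), integral_const_mul]
  have h2 : ∫ y in Set.Ioi (0 : ℝ), Real.exp (-(y - c) ^ 2 / 2) =
      ∫ t in Set.Ioi (-c), Real.exp (-t ^ 2 / 2) := by
    have := (measurePreserving_sub_right (volume : Measure ℝ) c).setIntegral_preimage_emb
      (measurableEmbedding_subRight c) (fun t => Real.exp (-t ^ 2 / 2)) (Set.Ioi (-c))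
    rw [← this]
    congr 2
    ext y
    simp
  rw [h2, cdf2_eq_integral_Ioi]
  have h3 : 2 * (√(2 * Real.pi))⁻¹ = √(2 / Real.pi) := by
    rw [Real.sqrt_mul (by norm_num), Real.sqrt_div (by norm_num)]
    have : √2 * √2 = 2 := Real.mul_self_sqrt (by norm_num)
    field_simp
    linarith
  rw [← h3]
  ring

lemma integral_exp_neg_mul_sq_gaussianReal {b : ℝ} (hb : 0 ≤ b) :
    ∫ x, Real.exp (-(b * x ^ 2)) ∂(gaussianReal 0 1) =
      Real.exp (-(1 / 2) * Real.log (1 + 2 * b)) := by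
  rw [integral_gaussianReal_eq_integral_smul one_ne_zero]
  have h1 : ∀ x : ℝ, gaussianPDFReal 0 1 x • Real.exp (-(b * x ^ 2)) =
      (√(2 * Real.pi))⁻¹ * Real.exp (-(b + 1 / 2) * x ^ 2) := by
    intro x
    simp only [gaussianPDFReal, NNReal.coe_one, mul_one, sub_zero, smul_eq_mul, mul_assoc,
      ← Real.exp_add]
    congr 2
    ring
  simp only [h1]
  rw [integral_const_mul, integral_gaussian, show Real.pi / (b + 1 / 2) =
    2 * Real.pi / (1 + 2 * b) by field_simp; ring, Real.sqrt_div (by positivity), ← mul_div_assoc,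
    inv_mul_cancel₀ (by positivity), one_div, ← Real.exp_log (by positivity : 0 < √(1 + 2 * b)),
    ← Real.exp_neg, Real.log_sqrt (by positivity)]
  congr 1
  ring

lemma integral_exp_mul_sum_abs_stdGauss {ν : Type*} [Fintype ν] (c : ℝ) :
    ∫ h, Real.exp (c * ∑ j, |h j|) ∂(stdGauss ν) =
      (Real.exp (c ^ 2 / 2) * cdf2 c) ^ Fintype.card ν := by
  simp only [Finset.mul_sum, Real.exp_sum, stdGauss]
  rw [integral_fintype_prod_eq_pow (fun x => Real.exp (c * |x|)),
    integral_exp_mul_abs_gaussianReal]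

lemma integral_exp_neg_mul_sum_sq_stdGauss {μ : Type*} [Fintype μ] {b : ℝ} (hb : 0 ≤ b) :
    ∫ g, Real.exp (-(b * ∑ i, g i ^ 2)) ∂(stdGauss μ) =
      Real.exp (-(Fintype.card μ / 2) * Real.log (1 + 2 * b)) := by
  simp only [Finset.mul_sum, ← Finset.sum_neg_distrib, Real.exp_sum, stdGauss]
  rw [integral_fintype_prod_eq_pow (fun x => Real.exp (-(b * x ^ 2))),
    integral_exp_neg_mul_sq_gaussianReal hb, ← Real.exp_nat_mul]
  congr 1
  ring

/-! ### The minimum over the cube and its Laplace transform -/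

/-- The point of the cube `{-1/√n, 1/√n}ⁿ` with the given signs. -/
noncomputable def cubePoint (n : ℕ) (s : Fin n → Bool) (j : Fin n) : ℝ :=
  if s j then 1 / √n else -(1 / √n)

lemma signCube_eq_range (n : ℕ) : signCube n = Set.range (cubePoint n) := by
  ext x
  constructor
  · intro hx
    refine ⟨fun j => decide (x j = 1 / √n), funext fun j => ?_⟩
    by_cases h : x j = 1 / √n
    · simp [cubePoint, h]
    · simp only [cubePoint, h, decide_false, Bool.false_eq_true, if_false]
      exact ((hx j).resolve_right h).symm
  · rintro ⟨s, rfl⟩ j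
    unfold cubePoint
    split_ifs <;> simp

lemma abs_cubePoint (n : ℕ) (s : Fin n → Bool) (j : Fin n) : |cubePoint n s j| = 1 / √n := by
  unfold cubePoint
  split_ifs <;> simp

lemma sum_cubePoint_sq {n : ℕ} (hn : 0 < n) (s : Fin n → Bool) : ∑ j, cubePoint n s j ^ 2 = 1 := by
  simp only [← sq_abs (cubePoint n s _), abs_cubePoint, div_pow, Real.sq_sqrt (Nat.cast_nonneg n)]
  simp [hn.ne']

lemma xi_eq_inf' {m n : ℕ} (A : Matrix (Fin m) (Fin n) ℝ) :
    xi A = Finset.univ.inf' Finset.univ_nonempty fun s => ‖WithLp.toLp 2 (A.mulVec (cubePoint n s))‖ := by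
  rw [Finset.inf'_univ_eq_ciInf, xi, signCube_eq_range, ← Set.range_comp]
  rfl

lemma exists_xi_eq {m n : ℕ} (A : Matrix (Fin m) (Fin n) ℝ) :
    ∃ s, xi A = ‖WithLp.toLp 2 (A.mulVec (cubePoint n s))‖ := by
  rw [xi_eq_inf']
  obtain ⟨s, -, hs⟩ := Finset.exists_mem_eq_inf' Finset.univ_nonempty
    fun s => ‖WithLp.toLp 2 (A.mulVec (cubePoint n s))‖
  exact ⟨s, hs⟩

lemma xi_le {m n : ℕ} (A : Matrix (Fin m) (Fin n) ℝ) (s : Fin n → Bool) :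
    xi A ≤ ‖WithLp.toLp 2 (A.mulVec (cubePoint n s))‖ := by
  rw [xi_eq_inf']
  exact Finset.inf'_le _ (Finset.mem_univ s)

lemma xi_nonneg {m n : ℕ} (A : Matrix (Fin m) (Fin n) ℝ) : 0 ≤ xi A := by
  obtain ⟨s, hs⟩ := exists_xi_eq A
  rw [hs]
  exact norm_nonneg _

lemma continuous_xi (m n : ℕ) : Continuous (xi (m := m) (n := n)) := by
  have : xi (m := m) (n := n) = fun A => Finset.univ.inf' Finset.univ_nonempty fun s =>
      ‖WithLp.toLp 2 (A.mulVec (cubePoint n s))‖ := funext xi_eq_inf'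
  rw [this]
  refine Continuous.finset_inf'_apply _ fun s _ => ?_
  refine continuous_norm.comp ((PiLp.continuous_toLp 2 _).comp ?_)
  exact Continuous.matrix_mulVec continuous_id continuous_const

lemma norm_toLp_mulVec {m n : ℕ} (A : Fin m × Fin n → ℝ) (x : Fin n → ℝ) :
    ‖WithLp.toLp 2 (Matrix.mulVec (Matrix.of fun i j => A (i, j)) x)‖ =
      √(∑ i, (∑ j, A (i, j) * x j) ^ 2) := by
  rw [EuclideanSpace.norm_eq]
  simp [Matrix.mulVec, dotProduct]

/-- The matrix with the given family of entries. -/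
def toMatrix {m n : ℕ} (A : Fin m × Fin n → ℝ) : Matrix (Fin m) (Fin n) ℝ :=
  Matrix.of fun i j => A (i, j)

lemma continuous_toMatrix (m n : ℕ) : Continuous (toMatrix (m := m) (n := n)) :=
  continuous_pi fun i => continuous_pi fun j => continuous_apply (i, j)

/-- With β = n, the 2ⁿ points of the cube cost (2ⁿ)^(1/n) = 2, which is negligible on the
exponential scale. -/
lemma softMax_linear_le {n : ℕ} (hn : 0 < n) {a : ℝ} (ha : 0 ≤ a) (h : Fin n → ℝ) :
    softMax a n (fun s => ∑ j, h j * cubePoint n s j) ≤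
      2 * Real.exp (a / √n * ∑ j, |h j|) := by
  have hn' : (0 : ℝ) < n := by exact_mod_cast hn
  have h1 : partition a n (fun s => ∑ j, h j * cubePoint n s j) ≤
      2 ^ n * Real.exp (n * (a / √n * ∑ j, |h j|)) := by
    calc partition a n (fun s => ∑ j, h j * cubePoint n s j)
        ≤ ∑ _s : Fin n → Bool, Real.exp (n * (a / √n * ∑ j, |h j|)) :=
          Finset.sum_le_sum fun s _ => by
            refine Real.exp_le_exp.2 ?_
            have : -(∑ j, h j * cubePoint n s j) ≤ 1 / √n * ∑ j, |h j| := by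
              rw [← Finset.sum_neg_distrib, Finset.mul_sum]
              refine Finset.sum_le_sum fun j _ => (neg_le_abs _).trans_eq ?_
              rw [abs_mul, abs_cubePoint, mul_comm]
            calc -(a * n * ∑ j, h j * cubePoint n s j)
                = a * n * -(∑ j, h j * cubePoint n s j) := by ring
              _ ≤ a * n * (1 / √n * ∑ j, |h j|) := mul_le_mul_of_nonneg_left this (by positivity)
              _ = _ := by ring
      _ = _ := by simp
  refine (Real.rpow_le_rpow (partition_pos _).le h1 (by positivity)).trans_eq ?_
  rw [Real.mul_rpow (by positivity) (Real.exp_pos _).le, ← Real.exp_mul, ← Real.rpow_natCast,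
    ← Real.rpow_mul (by norm_num), mul_one_div_cancel hn'.ne', Real.rpow_one]
  congr 2
  field_simp

lemma integrable_of_bounded {κ : Type*} [Fintype κ] {f : (κ → ℝ) → ℝ} (hf : Continuous f)
    (h0 : ∀ z, 0 ≤ f z) (h1 : ∀ z, f z ≤ 1) : Integrable f (stdGauss κ) :=
  Integrable.of_bound hf.aestronglyMeasurable 1
    (ae_of_all _ fun z => by rw [Real.norm_of_nonneg (h0 z)]; exact h1 z)

/-- The moment generating function of the minimum is bounded by one-dimensional quantities. -/
lemma integral_exp_neg_xi_le {m n : ℕ} (hn : 0 < n) {c : ℝ} (hc : 0 ≤ c) :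
    ∫ A, Real.exp (-(c * √n * xi (toMatrix A))) ∂(stdGauss (Fin m × Fin n)) ≤
      2 * Real.exp (c * √n) * cdf2 c ^ n *
        ∫ g, Real.exp (-(c * √n * √(∑ i, g i ^ 2))) ∂(stdGauss (Fin m)) := by
  set a := c * √n with ha_def
  have ha : 0 ≤ a := by positivity
  have hn1 : (1 : ℝ) ≤ n := by exact_mod_cast hn
  have hsq : 0 < √(n : ℝ) := by positivity
  have G := gordon_comparison (μ := Fin m) (a := a) (β := n) ha hn1
    (x := cubePoint n) (sum_cubePoint_sq hn)
  set I := ∫ A, softMax a n (fun s => √(1 + ∑ i, (∑ j, A (i, j) * cubePoint n s j) ^ 2))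
    ∂(stdGauss (Fin m × Fin n)) with hI
  have hcont : Continuous fun A : Fin m × Fin n → ℝ =>
      softMax a n (fun s => √(1 + ∑ i, (∑ j, A (i, j) * cubePoint n s j) ^ 2)) := by
    unfold softMax
    refine Continuous.rpow_const ?_ fun _ => Or.inl (partition_pos _).ne'
    unfold partition
    fun_prop
  have hint : Integrable (fun A : Fin m × Fin n → ℝ =>
      softMax a n (fun s => √(1 + ∑ i, (∑ j, A (i, j) * cubePoint n s j) ^ 2)))
      (stdGauss (Fin m × Fin n)) := by
    refine Integrable.of_bound hcont.aestronglyMeasurable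
      ((Fintype.card (Fin n → Bool) : ℝ) ^ (1 / (n : ℝ))) (ae_of_all _ fun A => ?_)
    rw [Real.norm_of_nonneg (softMax_pos _).le]
    refine Real.rpow_le_rpow (partition_pos _).le ?_ (by positivity)
    calc _ ≤ ∑ _s : Fin n → Bool, (1 : ℝ) := Finset.sum_le_sum fun s _ => by
          refine Real.exp_le_one_iff.2 (neg_nonpos.2 (by positivity))
      _ = _ := by simp
  have hxi : Continuous fun A : Fin m × Fin n → ℝ => Real.exp (-(a * xi (toMatrix A))) := by
    have := (continuous_xi m n).comp (continuous_toMatrix m n)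
    simp only [Function.comp_def] at this
    fun_prop
  have s1 : ∫ A, Real.exp (-(a * xi (toMatrix A))) ∂(stdGauss (Fin m × Fin n)) ≤
      Real.exp a * I := by
    rw [hI, ← integral_const_mul]
    refine integral_mono (integrable_of_bounded hxi (fun _ => (Real.exp_pos _).le) fun A =>
      Real.exp_le_one_iff.2 (neg_nonpos.2 (mul_nonneg ha (xi_nonneg _)))) (hint.const_mul _) ?_
    intro A
    obtain ⟨s, hs⟩ := exists_xi_eq (toMatrix A)
    -- Smoothing the norm costs at most 1, hence a factor exp(a) = exp(c√n), which is subexponential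
    -- in n.
    have h1 : √(1 + ∑ i, (∑ j, A (i, j) * cubePoint n s j) ^ 2) ≤ 1 + xi (toMatrix A) := by
      rw [hs, toMatrix, norm_toLp_mulVec]
      refine (Real.sqrt_le_left (by positivity)).2 ?_
      have h2 : 0 ≤ ∑ i, (∑ j, A (i, j) * cubePoint n s j) ^ 2 := by positivity
      nlinarith [Real.sq_sqrt h2, Real.sqrt_nonneg (∑ i, (∑ j, A (i, j) * cubePoint n s j) ^ 2)]
    have h3 := exp_le_softMax (a := a) (β := n) (by linarith)
      (fun s => √(1 + ∑ i, (∑ j, A (i, j) * cubePoint n s j) ^ 2)) s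
    calc Real.exp (-(a * xi (toMatrix A)))
        ≤ Real.exp (a + -(a * √(1 + ∑ i, (∑ j, A (i, j) * cubePoint n s j) ^ 2))) := by
          refine Real.exp_le_exp.2 ?_
          nlinarith [mul_le_mul_of_nonneg_left h1 ha]
      _ ≤ _ := by
          rw [Real.exp_add]
          exact mul_le_mul_of_nonneg_left h3 (Real.exp_pos _).le
  have s2 : ∫ g, Real.exp (-(a * √(1 + ∑ i, g i ^ 2))) ∂(stdGauss (Fin m)) ≤
      ∫ g, Real.exp (-(a * √(∑ i, g i ^ 2))) ∂(stdGauss (Fin m)) := by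
    refine integral_mono
      (integrable_of_bounded (by fun_prop) (fun _ => (Real.exp_pos _).le) fun g => ?_)
      (integrable_of_bounded (by fun_prop) (fun _ => (Real.exp_pos _).le) fun g => ?_) fun g => ?_
    · exact Real.exp_le_one_iff.2 (neg_nonpos.2 (by positivity))
    · exact Real.exp_le_one_iff.2 (neg_nonpos.2 (by positivity))
    · refine Real.exp_le_exp.2 (neg_le_neg (mul_le_mul_of_nonneg_left (Real.sqrt_le_sqrt ?_) ha))
      linarith
  have hac : a / √n = c := by rw [ha_def]; field_simp
  have s3 : ∫ h, softMax a n (fun s => ∑ j, h j * cubePoint n s j) ∂(stdGauss (Fin n)) ≤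
      2 * (Real.exp (c ^ 2 / 2) * cdf2 c) ^ n := by
    have e := integral_exp_mul_sum_abs_stdGauss (ν := Fin n) c
    rw [Fintype.card_fin] at e
    rw [← e, ← integral_const_mul]
    refine integral_mono_of_nonneg (ae_of_all _ fun _ => (softMax_pos _).le)
      ((integrable_exp_mul_sum_abs c).const_mul 2) (ae_of_all _ fun h => ?_)
    have := softMax_linear_le hn ha h
    rwa [hac] at this
  have hJ : 0 ≤ ∫ g, Real.exp (-(a * √(∑ i, g i ^ 2))) ∂(stdGauss (Fin m)) :=
    integral_nonneg fun _ => (Real.exp_pos _).le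
  have hS : 0 ≤ ∫ h, softMax a n (fun s => ∑ j, h j * cubePoint n s j) ∂(stdGauss (Fin n)) :=
    integral_nonneg fun _ => (softMax_pos _).le
  have G2 := G.trans (mul_le_mul s2 s3 hS hJ)
  have ha2 : a ^ 2 / 2 = n * (c ^ 2 / 2) := by
    rw [ha_def, mul_pow, Real.sq_sqrt (Nat.cast_nonneg n)]; ring
  -- The n Gaussian factors exp(c²/2) from h multiply to exp(a²/2), which cancels against the
  -- left-hand side of the comparison.
  rw [mul_pow (Real.exp (c ^ 2 / 2)), ← Real.exp_nat_mul, ← ha2] at G2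
  have G3 : I ≤ 2 * cdf2 c ^ n *
      ∫ g, Real.exp (-(a * √(∑ i, g i ^ 2))) ∂(stdGauss (Fin m)) := by
    refine le_of_mul_le_mul_left (G2.trans_eq ?_) (Real.exp_pos (a ^ 2 / 2))
    ring
  refine (s1.trans (mul_le_mul_of_nonneg_left G3 (Real.exp_pos a).le)).trans_eq ?_
  ring

/-! ### The rate function and its variational bounds -/

/-- The positive root `s` of `s² + c s = α`. -/
noncomputable def saddle (α c : ℝ) : ℝ := (√(c ^ 2 + 4 * α) - c) / 2

/-- The exponential rate of `E exp (-c √n ‖g‖)` for a Gaussian vector `g` of length `α n`. -/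
noncomputable def rate (α c : ℝ) : ℝ :=
  c * gammaHat α c - α / 2 * Real.log (1 - c / (2 * gammaHat α c))

section Rate

variable {α c : ℝ}

lemma gammaHat_eq (α c : ℝ) : gammaHat α c = -(saddle α c / 2) := by
  unfold gammaHat saddle
  rw [show 4 * c ^ 2 + 16 * α = 2 ^ 2 * (c ^ 2 + 4 * α) by ring, Real.sqrt_mul (by norm_num),
    Real.sqrt_sq (by norm_num)]
  ring

lemma saddle_pos (hα : 0 < α) (c : ℝ) : 0 < saddle α c := by
  have : c < √(c ^ 2 + 4 * α) := Real.lt_sqrt_of_sq_lt (by linarith)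
  unfold saddle
  linarith

lemma saddle_eq (hα : 0 < α) (c : ℝ) : saddle α c * (saddle α c + c) = α := by
  have h := Real.sq_sqrt (by positivity : 0 ≤ c ^ 2 + 4 * α)
  unfold saddle
  nlinarith

lemma saddle_add_pos (hα : 0 < α) (c : ℝ) : 0 < saddle α c + c := by
  have h1 := saddle_pos hα c
  have h2 := saddle_eq hα c
  by_contra h
  nlinarith

lemma rate_eq (hα : 0 < α) (c : ℝ) :
    rate α c = -(c * saddle α c / 2) - α / 2 * Real.log ((saddle α c + c) / saddle α c) := by
  have hs := saddle_pos hα c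
  unfold rate
  rw [gammaHat_eq, show 1 - c / (2 * -(saddle α c / 2)) = (saddle α c + c) / saddle α c by
    field_simp; ring]
  ring

lemma rate_eq_log (hα : 0 < α) (c : ℝ) :
    rate α c = α * Real.log (saddle α c) - c * saddle α c / 2 - α / 2 * Real.log α := by
  have hs := saddle_pos hα c
  have hsc := saddle_add_pos hα c
  have h := congrArg Real.log (saddle_eq hα c)
  rw [Real.log_mul hs.ne' hsc.ne'] at h
  rw [rate_eq hα, Real.log_div hsc.ne' hs.ne', ← h]
  ring

lemma objective_eq (hc : c ≠ 0) : objective α c = (Real.log (cdf2 c) + rate α c) / c := by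
  unfold objective rate cdf2
  rw [if_neg hc]
  field_simp
  ring

/-- Every choice of the multiplier gives a lower bound for the rate. -/
lemma le_rate (hα : 0 < α) (c : ℝ) {b : ℝ} (hb : 0 < b) :
    -(c ^ 2 / (4 * b)) - α / 2 * Real.log (1 + 2 * b) ≤ rate α c := by
  have hs := saddle_pos hα c
  have hsc := saddle_add_pos hα c
  have hα' := saddle_eq hα c
  rw [rate_eq hα]
  set s := saddle α c
  have hlog : Real.log ((s + c) / s) - Real.log (1 + 2 * b) ≤ (c / s - 2 * b) / (1 + 2 * b) := by
    rw [← Real.log_div (by positivity) (by positivity)]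
    refine (Real.log_le_sub_one_of_pos (by positivity)).trans_eq ?_
    field_simp
    ring
  have h1 := mul_le_mul_of_nonneg_left hlog (by positivity : 0 ≤ α / 2)
  -- The loss in the tangent bound for the logarithm combines into a perfect square, which vanishes
  -- at the optimal multiplier b = c / (2s).
  have h2 : c ^ 2 / (4 * b) - c * s / 2 - α / 2 * ((c / s - 2 * b) / (1 + 2 * b)) =
      (c - 2 * b * s) ^ 2 / (4 * b * (1 + 2 * b)) := by
    rw [← hα']
    field_simp
    ring
  have h3 : 0 ≤ (c - 2 * b * s) ^ 2 / (4 * b * (1 + 2 * b)) := by positivity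
  linarith

/-- The supporting lines of the rate. -/
lemma affine_le_rate (hα : 0 < α) (c : ℝ) {t : ℝ} (ht : 0 < t) :
    α * Real.log t - t ^ 2 / 2 - c * t + α / 2 - α / 2 * Real.log α ≤ rate α c := by
  have hs := saddle_pos hα c
  have hsc := saddle_add_pos hα c
  have hα' := saddle_eq hα c
  rw [rate_eq_log hα]
  set s := saddle α c
  have hlog : Real.log t - Real.log s ≤ t / s - 1 := by
    rw [← Real.log_div ht.ne' hs.ne']
    exact Real.log_le_sub_one_of_pos (by positivity)
  have h1 := mul_le_mul_of_nonneg_left hlog hα.le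
  have h2 : α * (t / s - 1) = (s + c) * (t - s) := by
    rw [← hα']; field_simp
  nlinarith [sq_nonneg (t - s)]

end Rate

/-! ### Laplace estimate for the norm of a Gaussian vector -/

/-- A finite family of Gaussian weights dominating `exp (-c √n r)`. -/
lemma exp_neg_le_sum_gaussian {c δ r : ℝ} (hc : 0 < c) (hδ : 0 < δ) (hr : 0 ≤ r) (N : ℕ) {n : ℕ}
    (hn : 0 < n) :
    Real.exp (-(c * √n * r)) ≤ ∑ j ∈ Finset.range N,
      Real.exp (n * (c * δ / 2 - c ^ 2 / (4 * (c / (2 * ((j + 1) * δ)))))) *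
        Real.exp (-(c / (2 * ((j + 1) * δ)) * r ^ 2)) + Real.exp (-(n * (c * (N * δ)))) := by
  have hn' : (0 : ℝ) < n := by exact_mod_cast hn
  have hsq : 0 < √(n : ℝ) := by positivity
  obtain ⟨s, hs, rfl⟩ : ∃ s : ℝ, 0 ≤ s ∧ r = √n * s :=
    ⟨r / √n, by positivity, by field_simp⟩
  have e1 : c * √n * (√n * s) = n * (c * s) := by
    rw [show c * √n * (√n * s) = √n * √n * (c * s) by ring, Real.mul_self_sqrt hn'.le]
  rw [e1, mul_pow, Real.sq_sqrt hn'.le]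
  have hnn : 0 ≤ ∑ j ∈ Finset.range N,
      Real.exp (n * (c * δ / 2 - c ^ 2 / (4 * (c / (2 * ((j + 1) * δ)))))) *
        Real.exp (-(c / (2 * ((j + 1) * δ)) * (n * s ^ 2))) := by positivity
  by_cases h : N * δ ≤ s
  · refine le_add_of_nonneg_of_le hnn (Real.exp_le_exp.2 (neg_le_neg ?_))
    exact mul_le_mul_of_nonneg_left (mul_le_mul_of_nonneg_left h hc.le) hn'.le
  · push Not at h
    -- With t = (j + 1)δ just above s, the tangent at t² to the square root, as a function of s²,
    -- replaces -cs by -ct/2 - cs²/(2t). This is below -cs by only c(t - s)²/(2t) ≤ cδ/2, and the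
    -- extra cδ/2 in the exponent compensates.
    set j := ⌊s / δ⌋₊ with hj
    have h1 : (j : ℝ) * δ ≤ s := by
      rw [← le_div_iff₀ hδ]; exact Nat.floor_le (by positivity)
    have h2 : s < (j + 1) * δ := by
      rw [← div_lt_iff₀ hδ]; exact Nat.lt_floor_add_one _
    have hjN : j < N := by
      have : (j : ℝ) * δ < N * δ := h1.trans_lt h
      exact_mod_cast lt_of_mul_lt_mul_right this hδ.le
    refine le_add_of_le_of_nonneg ?_ (Real.exp_pos _).le
    refine le_trans ?_ (Finset.single_le_sum (f := fun j : ℕ =>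
      Real.exp (n * (c * δ / 2 - c ^ 2 / (4 * (c / (2 * ((j + 1) * δ)))))) *
        Real.exp (-(c / (2 * ((j + 1) * δ)) * (n * s ^ 2)))) (fun _ _ => by positivity)
      (Finset.mem_range.2 hjN))
    simp only [← Real.exp_add]
    refine Real.exp_le_exp.2 ?_
    set t := ((j : ℝ) + 1) * δ with ht
    have htδ : δ ≤ t := by nlinarith [(Nat.cast_nonneg j : (0 : ℝ) ≤ j)]
    have ht0 : 0 < t := hδ.trans_le htδ
    have h3 : (t - s) ^ 2 ≤ δ * t := by
      have : t - s ≤ δ := by linarith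
      nlinarith
    have h4 : n * (c * δ / 2 - c ^ 2 / (4 * (c / (2 * t)))) + -(c / (2 * t) * (n * s ^ 2)) +
        n * (c * s) = n * c / (2 * t) * (δ * t - (t - s) ^ 2) := by
      field_simp
      ring
    have h5 : 0 ≤ n * c / (2 * t) * (δ * t - (t - s) ^ 2) :=
      mul_nonneg (by positivity) (by linarith)
    linarith

lemma integral_exp_neg_norm_le {c δ : ℝ} (hc : 0 < c) (hδ : 0 < δ) (N m : ℕ) {n : ℕ} (hn : 0 < n) :
    ∫ g, Real.exp (-(c * √n * √(∑ i, g i ^ 2))) ∂(stdGauss (Fin m)) ≤ ∑ j ∈ Finset.range N,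
      Real.exp (n * (c * δ / 2 - c ^ 2 / (4 * (c / (2 * ((j + 1) * δ)))))) *
        Real.exp (-(m / 2) * Real.log (1 + 2 * (c / (2 * ((j + 1) * δ))))) +
      Real.exp (-(n * (c * (N * δ)))) := by
  have hb (j : ℕ) : 0 ≤ c / (2 * ((j + 1) * δ)) := by positivity
  have hint (j : ℕ) : Integrable (fun g : Fin m → ℝ =>
      Real.exp (n * (c * δ / 2 - c ^ 2 / (4 * (c / (2 * ((j + 1) * δ)))))) *
        Real.exp (-(c / (2 * ((j + 1) * δ)) * ∑ i, g i ^ 2))) (stdGauss (Fin m)) := by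
    refine (integrable_of_bounded (by fun_prop) (fun _ => (Real.exp_pos _).le) fun g => ?_).const_mul _
    exact Real.exp_le_one_iff.2 (neg_nonpos.2 (mul_nonneg (hb j) (by positivity)))
  have h : ∫ g, (∑ j ∈ Finset.range N,
      Real.exp (n * (c * δ / 2 - c ^ 2 / (4 * (c / (2 * ((j + 1) * δ)))))) *
        Real.exp (-(c / (2 * ((j + 1) * δ)) * ∑ i, g i ^ 2)) + Real.exp (-(n * (c * (N * δ)))))
      ∂(stdGauss (Fin m)) = ∑ j ∈ Finset.range N,
      Real.exp (n * (c * δ / 2 - c ^ 2 / (4 * (c / (2 * ((j + 1) * δ)))))) *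
        Real.exp (-(m / 2) * Real.log (1 + 2 * (c / (2 * ((j + 1) * δ))))) +
      Real.exp (-(n * (c * (N * δ)))) := by
    rw [integral_add (integrable_finsetSum _ fun j _ => hint j) (integrable_const _),
      integral_finsetSum _ fun j _ => hint j]
    simp only [integral_const_mul, integral_exp_neg_mul_sum_sq_stdGauss (hb _), Fintype.card_fin]
    simp
  rw [← h]
  refine integral_mono (integrable_of_bounded (by fun_prop) (fun _ => (Real.exp_pos _).le)
    fun g => Real.exp_le_one_iff.2 (neg_nonpos.2 (by positivity)))
    ((integrable_finsetSum _ fun j _ => hint j).add (integrable_const _)) fun g => ?_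
  have := exp_neg_le_sum_gaussian hc hδ (Real.sqrt_nonneg (∑ i, g i ^ 2)) N hn
  rwa [Real.sq_sqrt (by positivity)] at this

lemma eventually_natCast_le_exp (K : ℝ) {ε : ℝ} (hε : 0 < ε) :
    ∀ᶠ n : ℕ in atTop, K ≤ Real.exp (n * ε) :=
  (Real.tendsto_exp_atTop.comp
    (tendsto_natCast_atTop_atTop.atTop_mul_const hε)).eventually_ge_atTop K

/-- Each Gaussian weight integrates in closed form, and `le_rate` bounds its exponent whatever its
multiplier. The number of weights does not depend on n, so their sum costs only exp(nε/2). -/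
lemma eventually_integral_exp_neg_norm_le {α c ε : ℝ} (hα : 0 < α) (hc : 0 < c) (hε : 0 < ε)
    {m : ℕ → ℕ} (hm : Tendsto (fun n : ℕ => (m n : ℝ) / (n : ℝ)) atTop (𝓝 α)) :
    ∀ᶠ n : ℕ in atTop, ∫ g, Real.exp (-(c * √n * √(∑ i, g i ^ 2))) ∂(stdGauss (Fin (m n))) ≤
      Real.exp (n * (rate α c + ε)) := by
  -- This mesh makes the discretization cost cδ/2 equal to ε/4; N is then taken so large that the
  -- tail decays at least as fast as exp(n · rate).
  set δ := ε / (2 * c) with hδ_def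
  have hδ : 0 < δ := by positivity
  obtain ⟨N, hN⟩ := exists_nat_ge (-rate α c / (c * δ))
  have hN' : -(c * (N * δ)) ≤ rate α c := by
    rw [div_le_iff₀ (by positivity)] at hN
    linarith
  have hlog : ∀ j ∈ Finset.range N, ∀ᶠ n : ℕ in atTop,
      -((m n : ℝ) / n / 2) * Real.log (1 + 2 * (c / (2 * ((j + 1) * δ)))) ≤
        -(α / 2) * Real.log (1 + 2 * (c / (2 * ((j + 1) * δ)))) + ε / 4 := fun j _ => by
    have ht := ((hm.div_const 2).neg.mul_const
      (Real.log (1 + 2 * (c / (2 * (((j : ℝ) + 1) * δ))))))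
    filter_upwards [ht.eventually_lt_const (lt_add_of_pos_right _ (by positivity : 0 < ε / 4))]
      with n hn using hn.le
  filter_upwards [(Finset.eventually_all _).2 hlog, eventually_gt_atTop 0,
    eventually_natCast_le_exp (N + 1) (by positivity : 0 < ε / 2)] with n h1 hn h2
  have hn' : (0 : ℝ) < n := by exact_mod_cast hn
  refine (integral_exp_neg_norm_le hc hδ N (m n) hn).trans ?_
  have hterm : ∀ j ∈ Finset.range N,
      Real.exp (n * (c * δ / 2 - c ^ 2 / (4 * (c / (2 * ((j + 1) * δ)))))) *
        Real.exp (-(m n / 2) * Real.log (1 + 2 * (c / (2 * ((j + 1) * δ))))) ≤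
      Real.exp (n * (rate α c + ε / 2)) := fun j hj => by
    rw [← Real.exp_add]
    refine Real.exp_le_exp.2 ?_
    have h3 := h1 j hj
    have h4 := le_rate hα c (by positivity : 0 < c / (2 * (((j : ℝ) + 1) * δ)))
    have h5 : c * δ / 2 = ε / 4 := by rw [hδ_def]; field_simp; norm_num
    have h6 : -((m n : ℝ) / 2) * Real.log (1 + 2 * (c / (2 * ((j + 1) * δ)))) =
        n * (-((m n : ℝ) / n / 2) * Real.log (1 + 2 * (c / (2 * ((j + 1) * δ))))) := by
      field_simp
    rw [h6, ← mul_add]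
    refine mul_le_mul_of_nonneg_left ?_ hn'.le
    linarith
  have hlast : Real.exp (-(n * (c * (N * δ)))) ≤ Real.exp (n * (rate α c + ε / 2)) := by
    refine Real.exp_le_exp.2 ?_
    rw [← mul_neg]
    exact mul_le_mul_of_nonneg_left (by linarith) hn'.le
  calc _ ≤ ∑ _j ∈ Finset.range N, Real.exp (n * (rate α c + ε / 2)) +
        Real.exp (n * (rate α c + ε / 2)) := add_le_add (Finset.sum_le_sum hterm) hlast
    _ = (N + 1) * Real.exp (n * (rate α c + ε / 2)) := by simp; ring
    _ ≤ Real.exp (n * (ε / 2)) * Real.exp (n * (rate α c + ε / 2)) :=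
        mul_le_mul_of_nonneg_right h2 (Real.exp_pos _).le
    _ = _ := by rw [← Real.exp_add]; ring_nf

/-- The key estimate for the moment generating function of the minimum. -/
theorem eventually_integral_exp_neg_xi_le {α c ε : ℝ} (hα : 0 < α) (hc : 0 < c) (hε : 0 < ε)
    {m : ℕ → ℕ} (hm : Tendsto (fun n : ℕ => (m n : ℝ) / (n : ℝ)) atTop (𝓝 α)) :
    ∀ᶠ n : ℕ in atTop,
      ∫ A, Real.exp (-(c * √n * xi (toMatrix A))) ∂(stdGauss (Fin (m n) × Fin n)) ≤
        Real.exp (n * (c * (objective α c + ε))) := by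
  have hsqrt : ∀ᶠ n : ℕ in atTop, c * √n ≤ n * (c * ε / 3) := by
    have : Tendsto (fun n : ℕ => √(n : ℝ)) atTop atTop :=
      Real.tendsto_sqrt_atTop.comp tendsto_natCast_atTop_atTop
    filter_upwards [this.eventually_ge_atTop (3 / ε)] with n hn
    rw [div_le_iff₀ hε] at hn
    have h1 : √(n : ℝ) * √n = n := Real.mul_self_sqrt (Nat.cast_nonneg n)
    have h2 := mul_le_mul_of_nonneg_left hn (mul_nonneg hc.le (Real.sqrt_nonneg (n : ℝ)))
    have h3 : (n : ℝ) * (c * ε / 3) = √n * √n * (c * ε / 3) := by rw [h1]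
    linarith
  filter_upwards [eventually_integral_exp_neg_norm_le hα hc (by positivity : 0 < c * ε / 3) hm,
    hsqrt, eventually_gt_atTop 0, eventually_natCast_le_exp 2 (by positivity : 0 < c * ε / 3)]
    with n h1 h2 hn h3
  have hp : 0 < cdf2 c := by linarith [one_le_cdf2 hc.le]
  refine (integral_exp_neg_xi_le hn hc.le).trans ?_
  have h4 : cdf2 c ^ n = Real.exp (n * Real.log (cdf2 c)) := by
    rw [Real.exp_nat_mul, Real.exp_log hp]
  have h5 : c * (objective α c + ε) = Real.log (cdf2 c) + rate α c + c * ε := by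
    rw [objective_eq hc.ne']; field_simp
  calc _ ≤ Real.exp (n * (c * ε / 3)) * Real.exp (n * (c * ε / 3)) *
        Real.exp (n * Real.log (cdf2 c)) * Real.exp (n * (rate α c + c * ε / 3)) := by
        rw [h4]
        gcongr
    _ = _ := by
        rw [← Real.exp_add, ← Real.exp_add, ← Real.exp_add, h5]
        ring_nf

/-! ### The objective and its minimum -/

section Objective

variable {α : ℝ}

lemma hasDerivAt_saddle (hα : 0 < α) (c : ℝ) :
    HasDerivAt (saddle α) ((c / √(c ^ 2 + 4 * α) - 1) / 2) c := by
  have h := ((((hasDerivAt_id c).fun_pow 2).add_const (4 * α)).sqrt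
    (by simp only [id]; positivity)).sub (hasDerivAt_id c)
  refine (h.div_const 2).congr_deriv ?_
  simp
  field_simp

/-- This is the envelope formula: the rate is a supremum of affine functions of c with slopes -t,
attained at t = `saddle α c`. -/
lemma hasDerivAt_rate (hα : 0 < α) (c : ℝ) : HasDerivAt (rate α) (-saddle α c) c := by
  have hs := saddle_pos hα c
  have h1 := hasDerivAt_saddle hα c
  rw [show rate α = fun c => α * Real.log (saddle α c) - c * saddle α c / 2 - α / 2 * Real.log α
    from funext (rate_eq_log hα)]
  have h2 := (((h1.log hs.ne').const_mul α).sub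
    (((hasDerivAt_id c).fun_mul h1).div_const 2)).sub_const (α / 2 * Real.log α)
  refine h2.congr_deriv ?_
  have hD : 0 < √(c ^ 2 + 4 * α) := by positivity
  have hsD : saddle α c = (√(c ^ 2 + 4 * α) - c) / 2 := rfl
  have hα' := saddle_eq hα c
  set s := saddle α c
  set D := √(c ^ 2 + 4 * α)
  have hDs : D = 2 * s + c := by linarith
  rw [← hα', hDs]
  rw [hDs] at hD
  have hne : 2 * s + c ≠ 0 := hD.ne'
  have hq : c / (2 * s + c) * (2 * s + c) = c := div_mul_cancel₀ c hne
  simp only [id]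
  generalize c / (2 * s + c) = q at hq ⊢
  have hs' : s * (s + c) * ((q - 1) / 2 / s) = (s + c) * ((q - 1) / 2) := by field_simp
  rw [hs']
  linear_combination hq / 4

lemma saddle_zero (α : ℝ) : saddle α 0 = √α := by
  unfold saddle
  rw [show (0 : ℝ) ^ 2 + 4 * α = 2 ^ 2 * α by ring, Real.sqrt_mul (by norm_num),
    Real.sqrt_sq (by norm_num)]
  ring

lemma rate_zero (hα : 0 < α) : rate α 0 = 0 := by
  rw [rate_eq_log hα, saddle_zero, Real.log_sqrt hα.le]
  ring

lemma hasDerivAt_log_cdf2 {c : ℝ} (hc : 0 ≤ c) :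
    HasDerivAt (fun c => Real.log (cdf2 c)) (√(2 / Real.pi) * Real.exp (-c ^ 2 / 2) / cdf2 c) c :=
  (hasDerivAt_cdf2 c).log (by linarith [one_le_cdf2 hc])

/-- The numerator log(cdf2 c) + rate α c vanishes at 0, so near 0 the objective is its difference
quotient and tends to its derivative √(2/π) - √α. -/
lemma continuousAt_objective (hα : 0 < α) {c : ℝ} (hc : 0 ≤ c) : ContinuousAt (objective α) c := by
  have hsum := (hasDerivAt_log_cdf2 hc).add (hasDerivAt_rate hα c)
  rcases hc.eq_or_lt with rfl | hpos
  · rw [continuousAt_iff_punctured_nhds]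
    have h0 : objective α 0 = √(2 / Real.pi) - √α := by simp [objective]
    have h1 := hasDerivAt_iff_tendsto_slope.1 hsum
    rw [cdf2_zero, saddle_zero] at h1
    have h2 : √(2 / Real.pi) * Real.exp (-(0 : ℝ) ^ 2 / 2) / 1 + -√α = √(2 / Real.pi) - √α := by
      simp [sub_eq_add_neg]
    rw [h2] at h1
    rw [h0]
    refine h1.congr' (eventually_nhdsWithin_of_forall fun x hx => ?_)
    rw [objective_eq hx, slope_def_field]
    simp [cdf2_zero, rate_zero hα]
  · have h1 : ContinuousAt (fun c => (Real.log (cdf2 c) + rate α c) / c) c :=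
      hsum.continuousAt.div continuousAt_id hpos.ne'
    refine h1.congr ?_
    filter_upwards [eventually_ne_nhds hpos.ne'] with x hx using (objective_eq hx).symm

/-- The term log(cdf2 c) stays bounded while the rate is unbounded below. -/
lemma exists_objective_neg (hα : 0 < α) : ∃ c, 0 < c ∧ objective α c < 0 := by
  -- This choice forces the logarithm in the rate to be at least 4/α; multiplied by α/2 it outweighs
  -- log(cdf2 c) < 2.
  set c := √(α * Real.exp (4 / α)) with hc_def
  have hc : 0 < c := by positivity
  refine ⟨c, hc, ?_⟩
  rw [objective_eq hc.ne']
  refine div_neg_of_neg_of_pos ?_ hc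
  have hs := saddle_pos hα c
  have hsc := saddle_eq hα c
  have h1 : Real.log (cdf2 c) < 2 := by
    have := Real.log_le_sub_one_of_pos (by linarith [one_le_cdf2 hc.le] : 0 < cdf2 c)
    linarith [cdf2_le_two (c := c)]
  have hc2 : c ^ 2 = α * Real.exp (4 / α) := Real.sq_sqrt (by positivity)
  have h2 : 4 / α ≤ Real.log ((saddle α c + c) / saddle α c) := by
    rw [Real.le_log_iff_exp_le (by positivity), le_div_iff₀ hs]
    refine le_of_mul_le_mul_left (a := α) ?_ hα
    have h3 : saddle α c * c ≤ α := by nlinarith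
    calc α * (Real.exp (4 / α) * saddle α c) = c * (saddle α c * c) := by
          rw [← mul_assoc, ← hc2]; ring
      _ ≤ c * α := mul_le_mul_of_nonneg_left h3 hc.le
      _ ≤ α * (saddle α c + c) := by nlinarith
  have h3 := mul_le_mul_of_nonneg_left h2 (by positivity : 0 ≤ α / 2)
  have h4 : α / 2 * (4 / α) = 2 := by field_simp; norm_num
  rw [rate_eq hα]
  have : 0 < c * saddle α c := by positivity
  linarith

/-- The supporting line of slope -η/2 bounds the rate below; its constant term disappears after
division by c, and log(cdf2 c) ≥ 0. -/
lemma eventually_neg_le_objective (hα : 0 < α) {η : ℝ} (hη : 0 < η) :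
    ∀ᶠ c : ℝ in atTop, -η ≤ objective α c := by
  set K := α * Real.log (η / 2) - (η / 2) ^ 2 / 2 + α / 2 - α / 2 * Real.log α with hK
  have ht : Tendsto (fun c : ℝ => K / c) atTop (𝓝 0) := tendsto_const_nhds.div_atTop tendsto_id
  filter_upwards [ht.eventually_const_lt (by linarith : -(η / 2) < 0), eventually_gt_atTop 0]
    with c h1 hc
  rw [objective_eq hc.ne', le_div_iff₀ hc]
  have h2 := affine_le_rate hα c (by positivity : 0 < η / 2)
  have h3 := Real.log_nonneg (one_le_cdf2 hc.le)
  rw [lt_div_iff₀ hc] at h1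
  linarith

/-- A continuous function on [0, ∞) that is negative somewhere and eventually above that negative
value attains its minimum. -/
lemma exists_isMinOn_objective (hα : 0 < α) :
    ∃ c₀, 0 ≤ c₀ ∧ objective α c₀ < 0 ∧ ∀ c, 0 ≤ c → objective α c₀ ≤ objective α c := by
  obtain ⟨c₁, hc₁, hneg⟩ := exists_objective_neg hα
  have hcont : ContinuousOn (objective α) (Set.Ici 0) := fun c hc =>
    (continuousAt_objective hα hc).continuousWithinAt
  obtain ⟨c₀, hc₀, hmin⟩ := hcont.exists_isMinOn' isClosed_Ici (Set.mem_Ici.2 hc₁.le) (by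
    have h := eventually_neg_le_objective hα (neg_pos.2 hneg)
    rw [neg_neg] at h
    rw [cocompact_eq_atBot_atTop, inf_sup_right, eventually_sup]
    refine ⟨?_, h.filter_mono inf_le_left⟩
    filter_upwards [mem_inf_of_left (eventually_lt_atBot (0 : ℝ)),
      mem_inf_of_right (mem_principal_self (Set.Ici (0 : ℝ)))] with c h1 h2
    exact absurd h1 (not_lt.2 h2))
  exact ⟨c₀, hc₀, (hmin (Set.mem_Ici.2 hc₁.le)).trans_lt hneg, fun c hc => hmin hc⟩

lemma xiLower_eq {c₀ : ℝ} (h0 : 0 ≤ c₀) (h : ∀ c, 0 ≤ c → objective α c₀ ≤ objective α c) :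
    xiLower α = -objective α c₀ := by
  have : IsLeast (objective α '' Set.Ici 0) (objective α c₀) :=
    ⟨Set.mem_image_of_mem _ h0, by rintro _ ⟨c, hc, rfl⟩; exact h c hc⟩
  rw [xiLower, this.csInf_eq]

lemma isLeast_objective (hα : 0 < α) : IsLeast (objective α '' Set.Ici 0) (-xiLower α) := by
  obtain ⟨c₀, h0, -, h⟩ := exists_isMinOn_objective hα
  rw [xiLower_eq h0 h, neg_neg]
  exact ⟨Set.mem_image_of_mem _ h0, by rintro _ ⟨c, hc, rfl⟩; exact h c hc⟩

lemma xiLower_pos (hα : 0 < α) : 0 < xiLower α := by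
  obtain ⟨c₀, h0, hneg, h⟩ := exists_isMinOn_objective hα
  rw [xiLower_eq h0 h]
  linarith

/-- The minimum is approximated at positive arguments. -/
lemma exists_pos_objective_lt (hα : 0 < α) {ε : ℝ} (hε : 0 < ε) :
    ∃ c, 0 < c ∧ objective α c < -xiLower α + ε := by
  obtain ⟨c₀, h0, -, h⟩ := exists_isMinOn_objective hα
  rw [xiLower_eq h0 h, neg_neg]
  have h1 : ∀ᶠ c in 𝓝 c₀, objective α c < objective α c₀ + ε :=
    (continuousAt_objective hα h0).eventually_lt_const (by linarith)
  have h2 : ∀ᶠ c in 𝓝[>] c₀, objective α c < objective α c₀ + ε := h1.filter_mono inf_le_left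
  obtain ⟨c, hc, hc'⟩ := (h2.and self_mem_nhdsWithin).exists
  exact ⟨c, h0.trans_lt hc', hc⟩

end Objective

/-! ### Certified bounds for the error function and the exponential -/

section ErrorFunction

/-- The product `1 · 3 · 5 ⋯ (2 k - 1)`. -/
def oddProd (k : ℕ) : ℝ := ∏ j ∈ Finset.range k, (2 * (j : ℝ) + 1)

lemma oddProd_pos (k : ℕ) : 0 < oddProd k := Finset.prod_pos fun _ _ => by positivity

/-- Partial sums of the series `∑ x^(2k+1) / (2k+1)!!`. -/
noncomputable def oddSeries (N : ℕ) (x : ℝ) : ℝ :=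
  ∑ k ∈ Finset.range N, x ^ (2 * k + 1) / oddProd (k + 1)

/-- The derivative telescopes: the Gaussian factor turns each term into minus the part produced by
differentiating the next power. -/
lemma hasDerivAt_exp_mul_oddSeries (N : ℕ) (x : ℝ) :
    HasDerivAt (fun x => Real.exp (-x ^ 2 / 2) * oddSeries N x)
      (Real.exp (-x ^ 2 / 2) * (1 - x ^ (2 * N) / oddProd N)) x := by
  have he : HasDerivAt (fun x : ℝ => Real.exp (-x ^ 2 / 2)) (-x * Real.exp (-x ^ 2 / 2)) x := by
    have := (((hasDerivAt_id x).fun_pow 2).fun_neg.div_const 2).exp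
    refine this.congr_deriv ?_
    simp
    ring
  induction N with
  | zero => simpa [oddSeries, oddProd] using hasDerivAt_const x (0 : ℝ)
  | succ N ih =>
    have hs : oddProd (N + 1) = oddProd N * (2 * N + 1) := Finset.prod_range_succ _ _
    have h1 := (hasDerivAt_pow (2 * N + 1) x).div_const (oddProd (N + 1))
    have h2 := ih.fun_add (he.fun_mul h1)
    refine (h2.congr_deriv ?_).congr_of_eventuallyEq (Eventually.of_forall fun y => ?_)
    · have h0 := (oddProd_pos N).ne'
      have h3 : (2 * (N : ℝ) + 1) ≠ 0 := by positivity
      rw [hs, show 2 * (N + 1) = 2 * N + 1 + 1 by ring, Nat.add_sub_cancel]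
      push_cast
      field_simp
      ring
    · simp only [oddSeries, Finset.sum_range_succ, mul_add]

lemma hasDerivAt_integral_exp (x : ℝ) :
    HasDerivAt (fun x => ∫ t in (0)..x, Real.exp (-t ^ 2 / 2)) (Real.exp (-x ^ 2 / 2)) x := by
  have hc : Continuous fun t : ℝ => Real.exp (-t ^ 2 / 2) := by fun_prop
  exact (hc.integral_hasStrictDerivAt 0 x).hasDerivAt

lemma oddSeries_zero_right (N : ℕ) : oddSeries N 0 = 0 :=
  Finset.sum_eq_zero fun k _ => by simp

/-- The difference has derivative exp(-y²/2) y^(2N) / oddProd N, which is nonnegative because the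
power is even; replacing the exponential by 1 gives the matching upper bound below. -/
lemma exp_mul_oddSeries_le (N : ℕ) {x : ℝ} (hx : 0 ≤ x) :
    Real.exp (-x ^ 2 / 2) * oddSeries N x ≤ ∫ t in (0)..x, Real.exp (-t ^ 2 / 2) := by
  have hd (y : ℝ) := (hasDerivAt_integral_exp y).fun_sub (hasDerivAt_exp_mul_oddSeries N y)
  have hmono := monotone_of_deriv_nonneg (fun y => (hd y).differentiableAt) fun y => by
    rw [(hd y).deriv]
    have : 0 ≤ y ^ (2 * N) / oddProd N :=
      div_nonneg (by rw [pow_mul]; positivity) (oddProd_pos N).le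
    nlinarith [Real.exp_pos (-y ^ 2 / 2)]
  have := hmono hx
  simp only [intervalIntegral.integral_same, oddSeries_zero_right, mul_zero, sub_zero] at this
  linarith

lemma integral_exp_le (N : ℕ) {x : ℝ} (hx : 0 ≤ x) :
    ∫ t in (0)..x, Real.exp (-t ^ 2 / 2) ≤
      Real.exp (-x ^ 2 / 2) * oddSeries N x + x ^ (2 * N + 1) / oddProd (N + 1) := by
  have hs : oddProd (N + 1) = oddProd N * (2 * N + 1) := Finset.prod_range_succ _ _
  have h0 := oddProd_pos N
  have hd (y : ℝ) := ((hasDerivAt_exp_mul_oddSeries N y).fun_add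
    ((hasDerivAt_pow (2 * N + 1) y).div_const (oddProd (N + 1)))).fun_sub
      (hasDerivAt_integral_exp y)
  have hmono := monotone_of_deriv_nonneg (fun y => (hd y).differentiableAt) fun y => by
    rw [(hd y).deriv, hs, Nat.add_sub_cancel]
    have h1 : 0 ≤ y ^ (2 * N) / oddProd N := div_nonneg (by rw [pow_mul]; positivity) h0.le
    have h2 : ((2 * N + 1 : ℕ) : ℝ) * y ^ (2 * N) / (oddProd N * (2 * N + 1)) =
        y ^ (2 * N) / oddProd N := by
      push_cast
      field_simp
    have h3 : Real.exp (-y ^ 2 / 2) ≤ 1 := Real.exp_le_one_iff.2 (by nlinarith [sq_nonneg y])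
    rw [h2]
    nlinarith
  have := hmono hx
  simp only [intervalIntegral.integral_same, oddSeries_zero_right, mul_zero, sub_zero, add_zero,
    ne_eq, Nat.add_eq_zero_iff, one_ne_zero, and_false, not_false_eq_true, zero_pow, zero_div] at this
  linarith

lemma sqrt_two_div_pi_bounds : 0.7978845 ≤ √(2 / Real.pi) ∧ √(2 / Real.pi) ≤ 0.7978846 := by
  have h1 := Real.pi_gt_d20
  have h2 := Real.pi_lt_d20
  constructor
  · refine Real.le_sqrt_of_sq_le ?_
    rw [le_div_iff₀ Real.pi_pos]
    nlinarith
  · refine (Real.sqrt_le_left (by norm_num)).2 ?_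
    rw [div_le_iff₀ Real.pi_pos]
    nlinarith

lemma le_cdf2 (N : ℕ) {x e S : ℝ} (hx : 0 ≤ x) (he0 : 0 ≤ e) (hS0 : 0 ≤ S)
    (he : e ≤ Real.exp (-x ^ 2 / 2)) (hS : S ≤ oddSeries N x) :
    1 + 0.7978845 * (e * S) ≤ cdf2 x := by
  rw [cdf2_eq]
  have h1 := exp_mul_oddSeries_le N hx
  have h2 : e * S ≤ Real.exp (-x ^ 2 / 2) * oddSeries N x :=
    mul_le_mul he hS hS0 (Real.exp_pos _).le
  have h3 := mul_le_mul sqrt_two_div_pi_bounds.1 (h2.trans h1) (by positivity) (by positivity)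
  linarith

lemma exp_le_taylor (n : ℕ) {x : ℝ} (hx : |x| ≤ 1) (hn : 0 < n) :
    Real.exp x ≤ ∑ k ∈ Finset.range n, x ^ k / k.factorial +
      |x| ^ n * (n.succ / (n.factorial * n)) := by
  have := (abs_le.1 (Real.exp_bound hx hn)).2
  linarith

lemma taylor_le_exp (n : ℕ) {x : ℝ} (hx : |x| ≤ 1) (hn : 0 < n) :
    ∑ k ∈ Finset.range n, x ^ k / k.factorial -
      |x| ^ n * (n.succ / (n.factorial * n)) ≤ Real.exp x := by
  have := (abs_le.1 (Real.exp_bound hx hn)).1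
  linarith

/-- The Taylor bounds require |x| ≤ 1; larger exponents are handled as powers. -/
lemma exp_le_pow_of_le {x y r : ℝ} (k : ℕ) (h : Real.exp y ≤ r) (hx : x = k * y) :
    Real.exp x ≤ r ^ k := by
  rw [hx, Real.exp_nat_mul]
  exact pow_le_pow_left₀ (Real.exp_pos _).le h k

lemma pow_le_exp_of_le {x y r : ℝ} (k : ℕ) (hr : 0 ≤ r) (h : r ≤ Real.exp y) (hx : x = k * y) :
    r ^ k ≤ Real.exp x := by
  rw [hx, Real.exp_nat_mul]
  exact pow_le_pow_left₀ hr h k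

end ErrorFunction

/-! ### Log-concavity and checking intervals at their endpoints -/

section Hazard

/-- The logarithmic derivative of `cdf2`. -/
noncomputable def hazard (c : ℝ) : ℝ := √(2 / Real.pi) * Real.exp (-c ^ 2 / 2) / cdf2 c

lemma hazard_pos {c : ℝ} (hc : 0 ≤ c) : 0 < hazard c := by
  have := one_le_cdf2 hc
  have := Real.pi_pos
  unfold hazard
  positivity

lemma hasDerivAt_hazard {c : ℝ} (hc : 0 ≤ c) :
    HasDerivAt hazard (-(hazard c * (c + hazard c))) c := by
  have h0 : cdf2 c ≠ 0 := by linarith [one_le_cdf2 hc]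
  have he : HasDerivAt (fun x : ℝ => √(2 / Real.pi) * Real.exp (-x ^ 2 / 2))
      (√(2 / Real.pi) * (-c * Real.exp (-c ^ 2 / 2))) c := by
    have := ((((hasDerivAt_id c).fun_pow 2).fun_neg.div_const 2).exp).const_mul (√(2 / Real.pi))
    refine this.congr_deriv ?_
    simp
    ring
  refine (he.fun_div (hasDerivAt_cdf2 c) h0).congr_deriv ?_
  unfold hazard
  field_simp
  ring

lemma antitoneOn_hazard : AntitoneOn hazard (Set.Ici 0) := by
  refine antitoneOn_of_deriv_nonpos (convex_Ici 0)
    (fun c hc => (hasDerivAt_hazard hc).continuousAt.continuousWithinAt) ?_ ?_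
  all_goals
    intro c hc
    rw [interior_Ici] at hc
    have hd := hasDerivAt_hazard (le_of_lt hc)
  · exact hd.differentiableAt.differentiableWithinAt
  · rw [hd.deriv]
    have := hazard_pos (le_of_lt hc)
    have : (0 : ℝ) < c := hc
    exact neg_nonpos.2 (by positivity)

/-- The derivative of the logarithm is the hazard, which decreases. -/
lemma concaveOn_log_cdf2 : ConcaveOn ℝ (Set.Ici 0) fun c => Real.log (cdf2 c) := by
  refine AntitoneOn.concaveOn_of_deriv (convex_Ici 0)
    (fun c hc => (hasDerivAt_log_cdf2 hc).continuousAt.continuousWithinAt) ?_ ?_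
  · intro c hc
    rw [interior_Ici] at hc
    exact (hasDerivAt_log_cdf2 (le_of_lt hc)).differentiableAt.differentiableWithinAt
  · rw [interior_Ici]
    intro x hx y hy hxy
    rw [(hasDerivAt_log_cdf2 (le_of_lt hx)).deriv, (hasDerivAt_log_cdf2 (le_of_lt hy)).deriv]
    exact antitoneOn_hazard (Set.Ioi_subset_Ici_self hx) (Set.Ioi_subset_Ici_self hy) hxy

/-- If the supporting line bound at slope `t` is nonnegative at both ends of an interval, then
`log (cdf2 c) + rate 1 c + κ c` is nonnegative on the interval. -/
lemma nonneg_of_endpoints {a b t κ : ℝ} (ha : 0 ≤ a) (ht : 0 < t)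
    (h1 : Real.exp (t ^ 2 / 2 + a * t - 1 / 2 - κ * a) ≤ cdf2 a * t)
    (h2 : Real.exp (t ^ 2 / 2 + b * t - 1 / 2 - κ * b) ≤ cdf2 b * t)
    {c : ℝ} (hac : a ≤ c) (hcb : c ≤ b) : 0 ≤ Real.log (cdf2 c) + rate 1 c + κ * c := by
  have hend {p : ℝ} (hp : 0 ≤ p) (h : Real.exp (t ^ 2 / 2 + p * t - 1 / 2 - κ * p) ≤ cdf2 p * t) :
      t ^ 2 / 2 + p * t - 1 / 2 - κ * p ≤ Real.log (cdf2 p) + Real.log t := by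
    have hp1 : 0 < cdf2 p := by linarith [one_le_cdf2 hp]
    rw [← Real.log_mul hp1.ne' ht.ne', Real.le_log_iff_exp_le (by positivity)]
    exact h
  have e1 := hend ha h1
  have e2 := hend (ha.trans (hac.trans hcb)) h2
  have h3 := affine_le_rate one_pos c ht
  rw [Real.log_one] at h3
  obtain ⟨u, v, hu, hv, huv, rfl⟩ : ∃ u v : ℝ, 0 ≤ u ∧ 0 ≤ v ∧ u + v = 1 ∧ u • a + v • b = c := by
    have : c ∈ segment ℝ a b := by rw [segment_eq_Icc (hac.trans hcb)]; exact ⟨hac, hcb⟩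
    obtain ⟨u, v, hu, hv, huv, h⟩ := this
    exact ⟨u, v, hu, hv, huv, h⟩
  -- With the rate replaced by a supporting line, the whole expression is concave in c, hence at
  -- least the interpolation of its endpoint values.
  have h4 := concaveOn_log_cdf2.2 (Set.mem_Ici.2 ha) (Set.mem_Ici.2 (ha.trans (hac.trans hcb)))
    hu hv huv
  simp only [smul_eq_mul] at h3 h4 ⊢
  have h5 := mul_le_mul_of_nonneg_left e1 hu
  have h6 := mul_le_mul_of_nonneg_left e2 hv
  have h7 : v = 1 - u := by linarith
  subst h7
  nlinarith

end Hazard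

/-! ### Case α = 1: numerical values and the interval [0, 23/10] -/

section Numerics

lemma cdf2_bound_first : 1.27 ≤ cdf2 (7 / 20) := by
  have he : 0.94 ≤ Real.exp (-(7 / 20 : ℝ) ^ 2 / 2) := by
    have := taylor_le_exp 3 (x := -(7 / 20 : ℝ) ^ 2 / 2) (by rw [abs_le]; norm_num) (by norm_num)
    refine le_trans ?_ this
    norm_num [Finset.sum_range_succ, Nat.factorial, abs_of_nonneg]
  have hS : 0.3642 ≤ oddSeries 2 (7 / 20) := by
    norm_num [oddSeries, oddProd, Finset.sum_range_succ, Finset.prod_range_succ]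
  refine le_trans ?_ (le_cdf2 2 (by norm_num) (by norm_num) (by norm_num) he hS)
  norm_num

lemma cdf2_bound_second : 1.62 ≤ cdf2 (9 / 10) := by
  have he : 0.666 ≤ Real.exp (-(9 / 10 : ℝ) ^ 2 / 2) := by
    have := taylor_le_exp 6 (x := -(9 / 10 : ℝ) ^ 2 / 2) (by rw [abs_le]; norm_num) (by norm_num)
    refine le_trans ?_ this
    norm_num [Finset.sum_range_succ, Nat.factorial, abs_of_nonneg]
  have hS : 1.182 ≤ oddSeries 3 (9 / 10) := by
    norm_num [oddSeries, oddProd, Finset.sum_range_succ, Finset.prod_range_succ]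
  refine le_trans ?_ (le_cdf2 3 (by norm_num) (by norm_num) (by norm_num) he hS)
  norm_num

lemma cdf2_bound_third : 1.88 ≤ cdf2 (8 / 5) := by
  have he : 0.5272 ^ 2 ≤ Real.exp (-(8 / 5 : ℝ) ^ 2 / 2) := by
    refine pow_le_exp_of_le (y := -16 / 25) 2 (by norm_num) ?_ (by norm_num)
    have := taylor_le_exp 8 (x := (-16 / 25 : ℝ)) (by rw [abs_le]; norm_num) (by norm_num)
    refine le_trans ?_ this
    norm_num [Finset.sum_range_succ, Nat.factorial, abs_of_nonneg]
  have hS : 3.992 ≤ oddSeries 5 (8 / 5) := by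
    norm_num [oddSeries, oddProd, Finset.sum_range_succ, Finset.prod_range_succ]
  refine le_trans ?_ (le_cdf2 5 (by norm_num) (by norm_num) (by norm_num) he hS)
  norm_num

lemma exp_bounds_fourth : 0.07095 ≤ Real.exp (-(23 / 10 : ℝ) ^ 2 / 2) ∧
    Real.exp (-(23 / 10 : ℝ) ^ 2 / 2) ≤ 0.07105 := by
  have h1 : (0.41405 : ℝ) ≤ Real.exp (-529 / 600) := by
    have := taylor_le_exp 9 (x := (-529 / 600 : ℝ)) (by rw [abs_le]; norm_num) (by norm_num)
    refine le_trans ?_ this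
    norm_num [Finset.sum_range_succ, Nat.factorial, abs_of_nonneg]
  have h2 : Real.exp (-529 / 600) ≤ (0.41412 : ℝ) := by
    have := exp_le_taylor 9 (x := (-529 / 600 : ℝ)) (by rw [abs_le]; norm_num) (by norm_num)
    refine this.trans ?_
    norm_num [Finset.sum_range_succ, Nat.factorial, abs_of_nonneg]
  have h3 := pow_le_exp_of_le (x := -(23 / 10 : ℝ) ^ 2 / 2) 3 (by norm_num) h1 (by norm_num)
  have h4 := exp_le_pow_of_le (x := -(23 / 10 : ℝ) ^ 2 / 2) 3 h2 (by norm_num)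
  exact ⟨le_trans (by norm_num) h3, h4.trans (by norm_num)⟩

lemma cdf2_bound_fourth : 1.975 ≤ cdf2 (23 / 10) := by
  have hS : 17.26 ≤ oddSeries 10 (23 / 10) := by
    norm_num [oddSeries, oddProd, Finset.sum_range_succ, Finset.prod_range_succ]
  refine le_trans ?_ (le_cdf2 10 (by norm_num) (by norm_num) (by norm_num) exp_bounds_fourth.1 hS)
  norm_num

/-- On `[0, 23/10]` the objective for `α = 1` is at least `-0.3201649`. -/
lemma nonneg_left {c : ℝ} (h0 : 0 ≤ c) (hc : c ≤ 23 / 10) :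
    0 ≤ Real.log (cdf2 c) + rate 1 c + 0.3201649 * c := by
  have key {a t B r : ℝ} (ht : 0 < t) (hB : B ≤ cdf2 a) (hr : r ≤ B * t)
      (hx : |t ^ 2 / 2 + a * t - 1 / 2 - 0.3201649 * a| ≤ 1)
      (hs : ∑ k ∈ Finset.range 5, (t ^ 2 / 2 + a * t - 1 / 2 - 0.3201649 * a) ^ k / k.factorial +
        |t ^ 2 / 2 + a * t - 1 / 2 - 0.3201649 * a| ^ 5 *
          ((5 : ℕ).succ / ((5 : ℕ).factorial * (5 : ℕ))) ≤ r) :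
      Real.exp (t ^ 2 / 2 + a * t - 1 / 2 - 0.3201649 * a) ≤ cdf2 a * t :=
    (exp_le_taylor 5 hx (by norm_num)).trans
      (hs.trans (hr.trans (mul_le_mul_of_nonneg_right hB ht.le)))
  -- On each interval the slope t lies between the values of `saddle 1` at the endpoints. On the
  -- first it must be 1, because the expression vanishes at c = 0 and only the line with t = 1 is
  -- exact there.
  rcases le_total c (7 / 20) with h1 | h1
  · refine nonneg_of_endpoints (a := 0) (b := 7 / 20) (t := 1) le_rfl one_pos
      (by simp [cdf2_zero]) (key one_pos cdf2_bound_first (r := 1.2690) ?_ ?_ ?_) h0 h1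
    · norm_num
    · rw [abs_le]; norm_num
    · norm_num [Finset.sum_range_succ, Nat.factorial, abs_of_nonneg, abs_of_nonpos]
  rcases le_total c (9 / 10) with h2 | h2
  · refine nonneg_of_endpoints (a := 7 / 20) (b := 9 / 10) (t := 3 / 4) (by norm_num) (by norm_num)
      (key (by norm_num) cdf2_bound_first (r := 0.94) ?_ ?_ ?_)
      (key (by norm_num) cdf2_bound_second (r := 1.2) ?_ ?_ ?_) h1 h2
    · norm_num
    · rw [abs_le]; norm_num
    · norm_num [Finset.sum_range_succ, Nat.factorial, abs_of_nonneg, abs_of_nonpos]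
    · norm_num
    · rw [abs_le]; norm_num
    · norm_num [Finset.sum_range_succ, Nat.factorial, abs_of_nonneg, abs_of_nonpos]
  rcases le_total c (8 / 5) with h3 | h3
  · refine nonneg_of_endpoints (a := 9 / 10) (b := 8 / 5) (t := 11 / 20) (by norm_num)
      (by norm_num) (key (by norm_num) cdf2_bound_second (r := 0.88) ?_ ?_ ?_)
      (key (by norm_num) cdf2_bound_third (r := 1.03) ?_ ?_ ?_) h2 h3
    · norm_num
    · rw [abs_le]; norm_num
    · norm_num [Finset.sum_range_succ, Nat.factorial, abs_of_nonneg, abs_of_nonpos]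
    · norm_num
    · rw [abs_le]; norm_num
    · norm_num [Finset.sum_range_succ, Nat.factorial, abs_of_nonneg, abs_of_nonpos]
  · refine nonneg_of_endpoints (a := 8 / 5) (b := 23 / 10) (t := 2 / 5) (by norm_num)
      (by norm_num) (key (by norm_num) cdf2_bound_third (r := 0.75) ?_ ?_ ?_)
      (key (by norm_num) cdf2_bound_fourth (r := 0.7899) ?_ ?_ ?_) h3 hc
    · norm_num
    · rw [abs_le]; norm_num
    · norm_num [Finset.sum_range_succ, Nat.factorial, abs_of_nonneg, abs_of_nonpos]
    · norm_num
    · rw [abs_le]; norm_num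
    · norm_num [Finset.sum_range_succ, Nat.factorial, abs_of_nonneg, abs_of_nonpos]

/-- Bounds for `exp (-c² / 2)` at a point close to the minimizer of the objective for `α = 1`. -/
lemma exp_bounds_min : 0.0267224756 ≤ Real.exp (-(404547 / 150302 : ℝ) ^ 2 / 2) ∧
    Real.exp (-(404547 / 150302 : ℝ) ^ 2 / 2) ≤ 0.0267224757 := by
  have h1 : (0.4043143656 : ℝ) ≤ Real.exp (-(404547 / 150302 : ℝ) ^ 2 / 8) := by
    have := taylor_le_exp 14 (x := -(404547 / 150302 : ℝ) ^ 2 / 8) (by rw [abs_le]; norm_num)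
      (by norm_num)
    refine le_trans ?_ this
    norm_num [Finset.sum_range_succ, Nat.factorial, abs_of_nonneg]
  have h2 : Real.exp (-(404547 / 150302 : ℝ) ^ 2 / 8) ≤ (0.4043143658 : ℝ) := by
    have := exp_le_taylor 14 (x := -(404547 / 150302 : ℝ) ^ 2 / 8) (by rw [abs_le]; norm_num)
      (by norm_num)
    refine this.trans ?_
    norm_num [Finset.sum_range_succ, Nat.factorial, abs_of_nonneg]
  have h3 := pow_le_exp_of_le (x := -(404547 / 150302 : ℝ) ^ 2 / 2) 4 (by norm_num) h1 (by norm_num)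
  have h4 := exp_le_pow_of_le (x := -(404547 / 150302 : ℝ) ^ 2 / 2) 4 h2 (by norm_num)
  exact ⟨le_trans (by norm_num) h3, h4.trans (by norm_num)⟩

lemma oddSeries_bounds_min : 46.5675699 ≤ oddSeries 20 (404547 / 150302) ∧
    oddSeries 20 (404547 / 150302) ≤ 46.5675700 := by
  constructor <;>
    norm_num [oddSeries, oddProd, Finset.sum_range_succ, Finset.prod_range_succ]

end Numerics

/-! ### Case α = 1: the half-line [23/10, ∞) and the value of the bound -/

section Square

lemma cdf2_bounds_min : 1.992888 ≤ cdf2 (404547 / 150302) ∧ cdf2 (404547 / 150302) ≤ 1.9928885 := by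
  obtain ⟨e1, e2⟩ := exp_bounds_min
  obtain ⟨s1, s2⟩ := oddSeries_bounds_min
  constructor
  · refine le_trans ?_ (le_cdf2 20 (by norm_num) (by norm_num) (by norm_num) e1 s1)
    norm_num
  · rw [cdf2_eq]
    have h1 := integral_exp_le 20 (x := 404547 / 150302) (by norm_num)
    have h2 : (404547 / 150302 : ℝ) ^ (2 * 20 + 1) / oddProd (20 + 1) ≤ 4e-8 := by
      norm_num [oddProd, Finset.prod_range_succ]
    have h3 := mul_le_mul e2 s2 (le_trans (by norm_num) s1) (by norm_num)
    have h4 : ∫ t in (0)..(404547 / 150302), Real.exp (-t ^ 2 / 2) ≤ 1.24440081 :=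
      h1.trans ((add_le_add h3 h2).trans (by norm_num))
    have h5 := mul_le_mul sqrt_two_div_pi_bounds.2 h4
      (intervalIntegral.integral_nonneg (by norm_num) fun _ _ => (Real.exp_pos _).le) (by norm_num)
    refine (add_le_add_right h5 1).trans (by norm_num)

/-- At this point the derivative of `minorant` is hazard - 223/674 + 0.3201649, so these bounds
place it between 0 and 0.000005. -/
lemma hazard_bounds_min : 223 / 674 - 0.3201649 ≤ hazard (404547 / 150302) ∧
    hazard (404547 / 150302) ≤ 223 / 674 - 0.3201649 + 0.000005 := by
  obtain ⟨e1, e2⟩ := exp_bounds_min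
  obtain ⟨c1, c2⟩ := cdf2_bounds_min
  obtain ⟨r1, r2⟩ := sqrt_two_div_pi_bounds
  have hpos : 0 < cdf2 (404547 / 150302) := lt_of_lt_of_le (by norm_num) c1
  unfold hazard
  constructor
  · rw [le_div_iff₀ hpos]
    have h1 := mul_le_mul r1 e1 (by norm_num) (Real.sqrt_nonneg _)
    refine le_trans ?_ h1
    refine (mul_le_mul_of_nonneg_left c2 (by norm_num)).trans (by norm_num)
  · rw [div_le_iff₀ hpos]
    have h1 := mul_le_mul r2 e2 (Real.exp_pos _).le (by norm_num)
    refine h1.trans ?_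
    refine le_trans (by norm_num) (mul_le_mul_of_nonneg_left c1 (by norm_num))

/-- This is the convexity of `minorant`: the Gaussian decay of the hazard makes the concavity of
log(cdf2) weaker than the convexity of the logarithmic term. -/
lemma hazard_mul_le {c : ℝ} (hc : 23 / 10 ≤ c) :
    hazard c * (c + hazard c) ≤ 1 / 2 / (223 / 674 + c) ^ 2 := by
  have hc0 : 0 ≤ c := by linarith
  have h1 : cdf2 (23 / 10) ≤ cdf2 c := by
    have hmono : Monotone cdf2 := monotone_of_deriv_nonneg
      (fun x => (hasDerivAt_cdf2 x).differentiableAt) fun x => by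
        rw [(hasDerivAt_cdf2 x).deriv]; positivity
    exact hmono hc
  have hcd : 1.975 ≤ cdf2 c := cdf2_bound_fourth.trans h1
  have hz0 := hazard_pos hc0
  obtain ⟨d, hd, rfl⟩ : ∃ d : ℝ, 0 ≤ d ∧ c = 23 / 10 + d := ⟨c - 23 / 10, by linarith, by ring⟩
  -- Here w = (c² - (23/10)²)/2, so the Gaussian factor is its value at 23/10 times exp(-w), and
  -- exp(w) ≥ 1 + w + w²/2 turns the claim into a polynomial inequality in d.
  set w := 23 / 10 * d + d ^ 2 / 2 with hw
  have hw0 : 0 ≤ w := by positivity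
  have hexp : Real.exp (-(23 / 10 + d) ^ 2 / 2) * (1 + w + w ^ 2 / 2) ≤ 0.07105 := by
    have e1 : Real.exp (-(23 / 10 + d) ^ 2 / 2) =
        Real.exp (-(23 / 10 : ℝ) ^ 2 / 2) * (Real.exp w)⁻¹ := by
      rw [← Real.exp_neg, ← Real.exp_add]
      congr 1
      rw [hw]
      ring
    rw [e1, mul_assoc]
    have e2 : (Real.exp w)⁻¹ * (1 + w + w ^ 2 / 2) ≤ 1 := by
      rw [inv_mul_le_one₀ (Real.exp_pos w)]
      exact Real.quadratic_le_exp_of_nonneg hw0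
    exact (mul_le_of_le_one_right (Real.exp_pos _).le e2).trans exp_bounds_fourth.2
  have hq : 0 < 1 + w + w ^ 2 / 2 := by positivity
  -- The constant is a rounding up of 0.7978846 · 0.07105 / 1.975.
  have hz : hazard (23 / 10 + d) * (1 + w + w ^ 2 / 2) ≤ 0.02871 := by
    unfold hazard
    rw [div_mul_eq_mul_div, div_le_iff₀ (by linarith), mul_assoc]
    have := mul_le_mul sqrt_two_div_pi_bounds.2 hexp (by positivity) (by norm_num)
    refine this.trans ?_
    refine le_trans (by norm_num) (mul_le_mul_of_nonneg_left hcd (by norm_num))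
  have hz1 : hazard (23 / 10 + d) ≤ 0.02871 := by
    refine le_trans ?_ hz
    exact le_mul_of_one_le_right hz0.le (by nlinarith [sq_nonneg w])
  rw [le_div_iff₀ (by positivity)]
  have hpoly : 0.02871 * (23 / 10 + d + 0.02871) * (223 / 674 + (23 / 10 + d)) ^ 2 ≤
      1 / 2 * (1 + w + w ^ 2 / 2) := by
    rw [hw, ← sub_nonneg]
    -- Every coefficient of this expansion in powers of d ≥ 0 is positive.
    have : 1 / 2 * (1 + (23 / 10 * d + d ^ 2 / 2) + (23 / 10 * d + d ^ 2 / 2) ^ 2 / 2) -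
        0.02871 * (23 / 10 + d + 0.02871) * (223 / 674 + (23 / 10 + d)) ^ 2 =
        (1 / 2 - 0.02871 * (23 / 10 + 0.02871) * (223 / 674 + 23 / 10) ^ 2)
        + (23 / 20 - 0.02871 * ((223 / 674 + 23 / 10) ^ 2 +
          2 * (23 / 10 + 0.02871) * (223 / 674 + 23 / 10))) * d
        + (1 / 4 + 529 / 400 - 0.02871 * (2 * (223 / 674 + 23 / 10) + 23 / 10 + 0.02871)) * d ^ 2
        + (23 / 40 - 0.02871) * d ^ 3 + 1 / 16 * d ^ 4 := by ring
    rw [this]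
    norm_num
    positivity
  have h5 : hazard (23 / 10 + d) * (23 / 10 + d + hazard (23 / 10 + d)) *
      (223 / 674 + (23 / 10 + d)) ^ 2 ≤ hazard (23 / 10 + d) *
        ((23 / 10 + d + 0.02871) * (223 / 674 + (23 / 10 + d)) ^ 2) := by
    rw [mul_assoc]
    gcongr
  refine h5.trans (le_of_mul_le_mul_right ?_ hq)
  calc hazard (23 / 10 + d) * ((23 / 10 + d + 0.02871) * (223 / 674 + (23 / 10 + d)) ^ 2) *
        (1 + w + w ^ 2 / 2)
      = hazard (23 / 10 + d) * (1 + w + w ^ 2 / 2) *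
        ((23 / 10 + d + 0.02871) * (223 / 674 + (23 / 10 + d)) ^ 2) := by ring
    _ ≤ 0.02871 * ((23 / 10 + d + 0.02871) * (223 / 674 + (23 / 10 + d)) ^ 2) :=
        mul_le_mul_of_nonneg_right hz (by positivity)
    _ = 0.02871 * (23 / 10 + d + 0.02871) * (223 / 674 + (23 / 10 + d)) ^ 2 := by ring
    _ ≤ _ := hpoly

/-- A convex minorant of `log (cdf2 c) + rate 1 c + 0.3201649 c` on `[23/10, ∞)`. -/
noncomputable def minorant (c : ℝ) : ℝ :=
  Real.log (cdf2 c) - 223 / 1348 * c - 1 / 2 * Real.log (1 + 674 / 223 * c) + 0.3201649 * c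

/-- The derivative of `minorant`. -/
noncomputable def minorantDeriv (c : ℝ) : ℝ :=
  hazard c - 223 / 1348 - 1 / 2 / (223 / 674 + c) + 0.3201649

/-- The multiplier b = c / (2s) with s = 223/674 held fixed makes c²/(4b) linear in c. It is optimal
at c = 404547/150302, where `saddle 1` equals s and the minorant touches. -/
lemma minorant_le {c : ℝ} (hc : 0 < c) :
    minorant c ≤ Real.log (cdf2 c) + rate 1 c + 0.3201649 * c := by
  have h := le_rate one_pos c (by positivity : 0 < 337 / 223 * c)
  have h1 : c ^ 2 / (4 * (337 / 223 * c)) = 223 / 1348 * c := by field_simp; norm_num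
  have h2 : 1 + 2 * (337 / 223 * c) = 1 + 674 / 223 * c := by ring
  rw [h1, h2] at h
  unfold minorant
  linarith

lemma hasDerivAt_minorant {c : ℝ} (hc : 0 ≤ c) : HasDerivAt minorant (minorantDeriv c) c := by
  have h0 : (1 + 674 / 223 * c) ≠ 0 := by positivity
  have h1 := ((hasDerivAt_id c).const_mul (674 / 223)).const_add 1
  have h2 := (((hasDerivAt_log_cdf2 hc).fun_sub ((hasDerivAt_id c).const_mul (223 / 1348))).fun_sub
    ((h1.log h0).const_mul (1 / 2))).fun_add ((hasDerivAt_id c).const_mul 0.3201649)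
  refine h2.congr_deriv ?_
  have h3 : (223 / 674 + c) ≠ 0 := by positivity
  have h4 : 1 / 2 * (674 / 223 * 1 / (1 + 674 / 223 * c)) = 1 / 2 / (223 / 674 + c) := by
    rw [show 1 + 674 / 223 * c = 674 / 223 * (223 / 674 + c) by ring]
    field_simp
  unfold minorantDeriv hazard
  simp only [id]
  rw [h4]
  ring

lemma hasDerivAt_minorantDeriv {c : ℝ} (hc : 0 ≤ c) : HasDerivAt minorantDeriv
    (-(hazard c * (c + hazard c)) + 1 / 2 / (223 / 674 + c) ^ 2) c := by
  have h3 : (223 / 674 + c) ≠ 0 := by positivity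
  have h1 := (hasDerivAt_const c (1 / 2 : ℝ)).fun_div ((hasDerivAt_id c).const_add (223 / 674)) h3
  have h2 := (((hasDerivAt_hazard hc).sub_const (223 / 1348)).fun_sub h1).add_const 0.3201649
  refine h2.congr_deriv ?_
  simp only [id]
  ring

lemma monotoneOn_minorantDeriv : MonotoneOn minorantDeriv (Set.Ici (23 / 10)) := by
  have hpos {c : ℝ} (hc : 23 / 10 ≤ c) : 0 ≤ c := by linarith
  refine monotoneOn_of_deriv_nonneg (convex_Ici _)
    (fun c hc => (hasDerivAt_minorantDeriv (hpos hc)).continuousAt.continuousWithinAt) ?_ ?_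
  all_goals
    intro c hc
    rw [interior_Ici] at hc
    have hc' : 23 / 10 ≤ c := le_of_lt hc
    have hd := hasDerivAt_minorantDeriv (hpos hc')
  · exact hd.differentiableAt.differentiableWithinAt
  · rw [hd.deriv]
    linarith [hazard_mul_le hc']

/-- With s = 223/674 and s(s + c) = 1, the argument (s + c)/s equals 1/s². -/
lemma log_eq_min : Real.log (1 + 674 / 223 * (404547 / 150302)) = -2 * Real.log (223 / 674) := by
  rw [show (1 + 674 / 223 * (404547 / 150302) : ℝ) = ((223 / 674) ^ 2)⁻¹ by norm_num, Real.log_inv,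
    Real.log_pow]
  push_cast
  ring

lemma minorant_min_ge : 0.000002 ≤ minorant (404547 / 150302) := by
  have hpos : 0 < cdf2 (404547 / 150302) := lt_of_lt_of_le (by norm_num) cdf2_bounds_min.1
  have h1 : 0.000002 + 223 / 1348 * (404547 / 150302) - 0.3201649 * (404547 / 150302) ≤
      Real.log (cdf2 (404547 / 150302)) + Real.log (223 / 674) := by
    rw [← Real.log_mul hpos.ne' (by norm_num), Real.le_log_iff_exp_le (by positivity)]
    refine (exp_le_taylor 10 (by rw [abs_le]; norm_num) (by norm_num)).trans ?_
    refine le_trans ?_ (mul_le_mul_of_nonneg_right cdf2_bounds_min.1 (by norm_num))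
    norm_num [Finset.sum_range_succ, Nat.factorial, abs_of_nonneg, abs_of_nonpos]
  unfold minorant
  rw [log_eq_min]
  linarith

/-- At c₁ the value is at least 0.000002 and the slope lies in [0, 0.000005]. By convexity the
function does not decrease to the right of c₁, and to the left it loses at most 0.000005 · (c₁ -
23/10) < 0.000002. -/
lemma minorant_nonneg {c : ℝ} (hc : 23 / 10 ≤ c) : 0 ≤ minorant c := by
  set c₁ : ℝ := 404547 / 150302 with hc₁
  have h1 : (23 / 10 : ℝ) ≤ c₁ := by norm_num [hc₁]
  have hτ : minorantDeriv c₁ = hazard c₁ - 223 / 674 + 0.3201649 := by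
    unfold minorantDeriv
    rw [hc₁]
    norm_num
    ring
  obtain ⟨b1, b2⟩ := hazard_bounds_min
  rw [← hc₁] at b1 b2
  have hmin := minorant_min_ge
  rw [← hc₁] at hmin
  have hd (x : ℝ) (hx : 23 / 10 ≤ x) := hasDerivAt_minorant (by linarith : 0 ≤ x)
  rcases lt_trichotomy c c₁ with h | h | h
  · obtain ⟨ξ, hξ, h2⟩ := exists_hasDerivAt_eq_slope minorant minorantDeriv h
      (fun x hx => (hd x (hc.trans hx.1)).continuousAt.continuousWithinAt)
      (fun x hx => hd x (hc.trans hx.1.le))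
    have h3 := monotoneOn_minorantDeriv (Set.mem_Ici.2 (hc.trans hξ.1.le)) (Set.mem_Ici.2 h1) hξ.2.le
    rw [h2, div_le_iff₀ (by linarith), hτ] at h3
    have h4 : (hazard c₁ - 223 / 674 + 0.3201649) * (c₁ - c) ≤ 0.000005 * (c₁ - 23 / 10) :=
      mul_le_mul (by linarith) (by linarith) (by linarith) (by norm_num)
    have h5 : 0.000005 * (c₁ - 23 / 10) ≤ 0.000002 := by rw [hc₁]; norm_num
    linarith
  · rw [h]; linarith
  · obtain ⟨ξ, hξ, h2⟩ := exists_hasDerivAt_eq_slope minorant minorantDeriv h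
      (fun x hx => (hd x (h1.trans hx.1)).continuousAt.continuousWithinAt)
      (fun x hx => hd x (h1.trans hx.1.le))
    have h3 := monotoneOn_minorantDeriv (Set.mem_Ici.2 h1) (Set.mem_Ici.2 (h1.trans hξ.1.le)) hξ.1.le
    rw [h2, le_div_iff₀ (by linarith), hτ] at h3
    have h4 : 0 ≤ (hazard c₁ - 223 / 674 + 0.3201649) * (c - c₁) :=
      mul_nonneg (by linarith) (by linarith)
    linarith

lemma objective_one_ge {c : ℝ} (hc : 0 < c) : -0.3201649 ≤ objective 1 c := by
  rw [objective_eq hc.ne', le_div_iff₀ hc]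
  rcases le_total c (23 / 10) with h | h
  · linarith [nonneg_left hc.le h]
  · linarith [minorant_nonneg h, minorant_le hc]

/-- The test point is 1/s - s for s = 223/674, so the square root in the saddle is rational. -/
lemma saddle_min : saddle 1 (404547 / 150302) = 223 / 674 := by
  unfold saddle
  rw [show ((404547 / 150302 : ℝ) ^ 2 + 4 * 1) = (504005 / 150302) ^ 2 by norm_num,
    Real.sqrt_sq (by norm_num)]
  norm_num

lemma objective_one_le : objective 1 (404547 / 150302) ≤ -0.3201601 := by
  have hpos : 0 < cdf2 (404547 / 150302) := lt_of_lt_of_le (by norm_num) cdf2_bounds_min.1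
  rw [objective_eq (by norm_num), div_le_iff₀ (by norm_num), rate_eq_log one_pos, saddle_min,
    Real.log_one]
  have h1 : Real.log (cdf2 (404547 / 150302)) + Real.log (223 / 674) ≤
      223 / 1348 * (404547 / 150302) - 0.3201601 * (404547 / 150302) := by
    rw [← Real.log_mul hpos.ne' (by norm_num), Real.log_le_iff_le_exp (by positivity)]
    refine (mul_le_mul_of_nonneg_right cdf2_bounds_min.2 (by norm_num)).trans ?_
    refine le_trans ?_ (taylor_le_exp 10 (by rw [abs_le]; norm_num) (by norm_num))
    norm_num [Finset.sum_range_succ, Nat.factorial, abs_of_nonneg, abs_of_nonpos]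
  linarith

lemma xiLower_one_bounds : 0.3201601 ≤ xiLower 1 ∧ xiLower 1 ≤ 0.3201649 := by
  have hl := isLeast_objective one_pos
  constructor
  · have := hl.2 (Set.mem_image_of_mem (objective 1)
      (Set.mem_Ici.2 (by norm_num : (0 : ℝ) ≤ 404547 / 150302)))
    linarith [objective_one_le]
  -- The lower bound on the objective is available only for c > 0, so the minimum is approached
  -- through positive arguments.
  · refine le_of_forall_pos_le_add fun ε hε => ?_
    obtain ⟨c, hc, h⟩ := exists_pos_objective_lt one_pos hε
    linarith [objective_one_ge hc]

end Square

/-! ### From the Gaussian product measure to the random matrix -/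

lemma toMatrix_entries {m n : ℕ} (A : Matrix (Fin m) (Fin n) ℝ) :
    toMatrix (fun p => A p.1 p.2) = A := rfl

section Transfer

variable {m n : ℕ} {Ω : Type*} [MeasurableSpace Ω] {P : Measure Ω}
  {H : Ω → Matrix (Fin m) (Fin n) ℝ}

lemma aemeasurable_xi (hlaw : ∀ i j, HasLaw (fun ω => H ω i j) (gaussianReal 0 1) P) :
    AEMeasurable (fun ω => xi (H ω)) P := by
  have h : AEMeasurable (fun ω (p : Fin m × Fin n) => H ω p.1 p.2) P :=
    aemeasurable_pi_lambda _ fun p => (hlaw p.1 p.2).aemeasurable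
  have hc : Measurable fun A : Fin m × Fin n → ℝ => xi (toMatrix A) :=
    ((continuous_xi m n).comp (continuous_toMatrix m n)).measurable
  have := hc.comp_aemeasurable h
  simpa only [Function.comp_def, toMatrix_entries] using this

/-- The minimum is at most the value at the all-plus vertex, whose ℓ² norm is at most its ℓ¹ norm, a
linear combination of the |H i j|. -/
lemma integrable_xi (hlaw : ∀ i j, HasLaw (fun ω => H ω i j) (gaussianReal 0 1) P) :
    Integrable (fun ω => xi (H ω)) P := by
  have hent (i : Fin m) (j : Fin n) : Integrable (fun ω => H ω i j) P := by
    have h1 : Integrable (id : ℝ → ℝ) (P.map fun ω => H ω i j) := by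
      rw [(hlaw i j).map_eq]
      exact (memLp_id_gaussianReal 1).integrable le_rfl
    exact (integrable_map_measure aestronglyMeasurable_id (hlaw i j).aemeasurable).1 h1
  have hdom : Integrable (fun ω => ∑ i, ∑ j, |H ω i j| * (1 / √n)) P :=
    integrable_finsetSum _ fun i _ => integrable_finsetSum _ fun j _ =>
      ((hent i j).abs).mul_const _
  refine hdom.mono' (aemeasurable_xi hlaw).aestronglyMeasurable (ae_of_all _ fun ω => ?_)
  rw [Real.norm_of_nonneg (xi_nonneg _)]
  refine (xi_le (H ω) fun _ => true).trans ?_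
  rw [EuclideanSpace.norm_eq]
  refine (Real.sqrt_le_sqrt (Finset.sum_sq_le_sq_sum_of_nonneg fun i _ => norm_nonneg _)).trans ?_
  rw [Real.sqrt_sq (Finset.sum_nonneg fun i _ => norm_nonneg _)]
  refine Finset.sum_le_sum fun i _ => ?_
  change |∑ j, H ω i j * cubePoint n (fun _ => true) j| ≤ _
  refine (Finset.abs_sum_le_sum_abs _ _).trans ?_
  exact Finset.sum_le_sum fun j _ => by rw [abs_mul, abs_cubePoint]

lemma hasLaw_entries [IsProbabilityMeasure P] (hlaw : ∀ i j, HasLaw (fun ω => H ω i j) (gaussianReal 0 1) P)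
    (hindep : iIndepFun (fun (p : Fin m × Fin n) ω => H ω p.1 p.2) P) :
    HasLaw (fun ω (p : Fin m × Fin n) => H ω p.1 p.2) (stdGauss (Fin m × Fin n)) P where
  aemeasurable := aemeasurable_pi_lambda _ fun p => (hlaw p.1 p.2).aemeasurable
  map_eq := by
    have h := hindep.map_fun_eq_pi_map fun (p : Fin m × Fin n) => (hlaw p.1 p.2).aemeasurable
    have h2 : (fun p : Fin m × Fin n => P.map fun ω => H ω p.1 p.2) =
        fun _ => gaussianReal 0 1 := funext fun p => (hlaw p.1 p.2).map_eq
    exact h.trans (congrArg Measure.pi h2)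

variable [IsProbabilityMeasure P]

lemma integral_exp_neg_xi_eq (hlaw : ∀ i j, HasLaw (fun ω => H ω i j) (gaussianReal 0 1) P)
    (hindep : iIndepFun (fun (p : Fin m × Fin n) ω => H ω p.1 p.2) P) (a : ℝ) :
    ∫ ω, Real.exp (-(a * xi (H ω))) ∂P =
      ∫ A, Real.exp (-(a * xi (toMatrix A))) ∂(stdGauss (Fin m × Fin n)) := by
  have hL := hasLaw_entries hlaw hindep
  have hxi : Continuous fun A : Fin m × Fin n → ℝ => Real.exp (-(a * xi (toMatrix A))) := by
    have := (continuous_xi m n).comp (continuous_toMatrix m n)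
    simp only [Function.comp_def] at this
    fun_prop
  rw [← hL.map_eq, integral_map hL.aemeasurable hxi.aestronglyMeasurable]
  simp only [toMatrix_entries]

/-- Jensen's inequality for the exponential. -/
lemma exp_neg_integral_xi_le (hlaw : ∀ i j, HasLaw (fun ω => H ω i j) (gaussianReal 0 1) P)
    {a : ℝ} (ha : 0 ≤ a) :
    Real.exp (-(a * ∫ ω, xi (H ω) ∂P)) ≤ ∫ ω, Real.exp (-(a * xi (H ω))) ∂P := by
  have hint := integrable_xi hlaw
  have hexp : Integrable (fun ω => Real.exp (-(a * xi (H ω)))) P := by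
    refine Integrable.of_bound (((aemeasurable_xi hlaw).const_mul a).neg.exp).aestronglyMeasurable 1
      (ae_of_all _ fun ω => ?_)
    rw [Real.norm_of_nonneg (Real.exp_pos _).le]
    exact Real.exp_le_one_iff.2 (neg_nonpos.2 (mul_nonneg ha (xi_nonneg _)))
  have := convexOn_exp.map_integral_le (μ := P) (f := fun ω => -(a * xi (H ω)))
    Real.continuous_exp.continuousOn isClosed_univ (ae_of_all _ fun _ => Set.mem_univ _)
    (hint.const_mul a).neg hexp
  rwa [integral_neg, integral_const_mul] at this

/-- The exponential Markov inequality for the lower tail. -/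
lemma measure_xi_lt_le (hlaw : ∀ i j, HasLaw (fun ω => H ω i j) (gaussianReal 0 1) P)
    {a : ℝ} (ha : 0 ≤ a) (t : ℝ) :
    P {ω | xi (H ω) < t} ≤
      ENNReal.ofReal (Real.exp (a * t) * ∫ ω, Real.exp (-(a * xi (H ω))) ∂P) := by
  have hexp : Integrable (fun ω => Real.exp (-(a * xi (H ω)))) P := by
    refine Integrable.of_bound (((aemeasurable_xi hlaw).const_mul a).neg.exp).aestronglyMeasurable 1
      (ae_of_all _ fun ω => ?_)
    rw [Real.norm_of_nonneg (Real.exp_pos _).le]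
    exact Real.exp_le_one_iff.2 (neg_nonpos.2 (mul_nonneg ha (xi_nonneg _)))
  have h1 := mul_meas_ge_le_integral_of_nonneg (μ := P) (ae_of_all _ fun ω => (Real.exp_pos _).le)
    hexp (Real.exp (-(a * t)))
  have h2 : P.real {ω | xi (H ω) < t} ≤ P.real {ω | Real.exp (-(a * t)) ≤
      Real.exp (-(a * xi (H ω)))} := by
    refine measureReal_mono fun ω hω => Real.exp_le_exp.2 (neg_le_neg ?_)
    exact mul_le_mul_of_nonneg_left (le_of_lt hω) ha
  rw [← ofReal_measureReal]
  refine ENNReal.ofReal_le_ofReal ?_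
  have h3 := (mul_le_mul_of_nonneg_left h2 (Real.exp_pos (-(a * t))).le).trans h1
  rw [Real.exp_neg, inv_mul_le_iff₀ (Real.exp_pos _)] at h3
  exact h3

end Transfer

/-! ### Asymptotic bounds for the mean and in probability -/

section Asymptotic

variable {α : ℝ} {m : ℕ → ℕ} {Ω : ℕ → Type*} [∀ n, MeasurableSpace (Ω n)]
  {P : ∀ n, Measure (Ω n)} [∀ n, IsProbabilityMeasure (P n)]
  {H : ∀ n, Ω n → Matrix (Fin (m n)) (Fin n) ℝ}

/-- Half of ε pays for using a nearly minimizing c > 0 instead of the minimizer, the other half for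
the error in the exponential estimate. -/
lemma eventually_mgf_le (hα : 0 < α)
    (hm : Tendsto (fun n : ℕ => (m n : ℝ) / (n : ℝ)) atTop (𝓝 α))
    (hlaw : ∀ n i j, HasLaw (fun ω => H n ω i j) (gaussianReal 0 1) (P n))
    (hindep : ∀ n, iIndepFun (fun (p : Fin (m n) × Fin n) ω => H n ω p.1 p.2) (P n))
    {ε : ℝ} (hε : 0 < ε) :
    ∃ c, 0 < c ∧ ∀ᶠ n : ℕ in atTop, ∫ ω, Real.exp (-(c * √n * xi (H n ω))) ∂(P n) ≤
      Real.exp (n * (c * (-xiLower α + ε))) := by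
  obtain ⟨c, hc, hlt⟩ := exists_pos_objective_lt hα (by positivity : 0 < ε / 2)
  refine ⟨c, hc, ?_⟩
  filter_upwards [eventually_integral_exp_neg_xi_le hα hc (by positivity : 0 < ε / 2) hm]
    with n hn
  rw [integral_exp_neg_xi_eq (hlaw n) (hindep n)]
  refine hn.trans (Real.exp_le_exp.2 ?_)
  have : objective α c + ε / 2 ≤ -xiLower α + ε := by linarith
  gcongr

lemma eventually_le_integral_xi (hα : 0 < α)
    (hm : Tendsto (fun n : ℕ => (m n : ℝ) / (n : ℝ)) atTop (𝓝 α))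
    (hlaw : ∀ n i j, HasLaw (fun ω => H n ω i j) (gaussianReal 0 1) (P n))
    (hindep : ∀ n, iIndepFun (fun (p : Fin (m n) × Fin n) ω => H n ω p.1 p.2) (P n))
    {ε : ℝ} (hε : 0 < ε) :
    ∀ᶠ n : ℕ in atTop, xiLower α - ε ≤ (∫ ω, xi (H n ω) ∂(P n)) / √n := by
  obtain ⟨c, hc, h⟩ := eventually_mgf_le hα hm hlaw hindep hε
  filter_upwards [h, eventually_gt_atTop 0] with n h1 hn
  have hn' : (0 : ℝ) < n := by exact_mod_cast hn
  have hsq : 0 < √(n : ℝ) := by positivity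
  have h2 := (exp_neg_integral_xi_le (hlaw n) (by positivity : 0 ≤ c * √n)).trans h1
  rw [Real.exp_le_exp] at h2
  rw [le_div_iff₀ hsq]
  have h3 : √(n : ℝ) * √n = n := Real.mul_self_sqrt hn'.le
  have h4 : (n : ℝ) * (c * (-xiLower α + ε)) = c * √n * ((-xiLower α + ε) * √n) := by
    linear_combination (-c * (-xiLower α + ε)) * h3
  rw [h4, ← mul_neg] at h2
  have := le_of_mul_le_mul_left h2 (by positivity : 0 < c * √n)
  linarith

/-- Using the Laplace bound with ε/2 against the threshold with ε leaves probability at most exp(-n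
c ε/2). -/
lemma tendsto_measure_xi_lt (hα : 0 < α)
    (hm : Tendsto (fun n : ℕ => (m n : ℝ) / (n : ℝ)) atTop (𝓝 α))
    (hlaw : ∀ n i j, HasLaw (fun ω => H n ω i j) (gaussianReal 0 1) (P n))
    (hindep : ∀ n, iIndepFun (fun (p : Fin (m n) × Fin n) ω => H n ω p.1 p.2) (P n))
    {ε : ℝ} (hε : 0 < ε) :
    Tendsto (fun n : ℕ => P n {ω | xi (H n ω) < (xiLower α - ε) * √n}) atTop (𝓝 0) := by
  obtain ⟨c, hc, h⟩ := eventually_mgf_le hα hm hlaw hindep (by positivity : 0 < ε / 2)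
  have hlim : Tendsto (fun n : ℕ => ENNReal.ofReal (Real.exp (-(n * (c * (ε / 2)))))) atTop (𝓝 0) := by
    rw [← ENNReal.ofReal_zero]
    refine ENNReal.tendsto_ofReal (Real.tendsto_exp_neg_atTop_nhds_zero.comp ?_)
    exact tendsto_natCast_atTop_atTop.atTop_mul_const (by positivity)
  refine tendsto_of_tendsto_of_tendsto_of_le_of_le' tendsto_const_nhds hlim
    (Eventually.of_forall fun _ => zero_le) ?_
  filter_upwards [h] with n h1
  refine (measure_xi_lt_le (hlaw n) (by positivity : 0 ≤ c * √n) _).trans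
    (ENNReal.ofReal_le_ofReal ?_)
  have h3 : √(n : ℝ) * √n = n := Real.mul_self_sqrt (Nat.cast_nonneg n)
  refine (mul_le_mul_of_nonneg_left h1 (Real.exp_pos _).le).trans_eq ?_
  rw [← Real.exp_add]
  congr 1
  linear_combination (c * (xiLower α - ε)) * h3

lemma tendsto_measure_one_of_subset (hlaw : ∀ n i j, HasLaw (fun ω => H n ω i j) (gaussianReal 0 1) (P n))
    {t : ℕ → ℝ} (ht : Tendsto (fun n : ℕ => P n {ω | xi (H n ω) < t n}) atTop (𝓝 0))
    {S : ∀ n, Set (Ω n)} (hS : ∀ᶠ n in atTop, {ω | t n ≤ xi (H n ω)} ⊆ S n) :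
    Tendsto (fun n => P n (S n)) atTop (𝓝 1) := by
  have h1 : Tendsto (fun n : ℕ => 1 - P n {ω | xi (H n ω) < t n}) atTop (𝓝 1) := by
    have := ENNReal.Tendsto.sub (tendsto_const_nhds (x := (1 : ENNReal))) ht
      (Or.inl ENNReal.one_ne_top)
    simpa using this
  refine tendsto_of_tendsto_of_tendsto_of_le_of_le' h1 tendsto_const_nhds ?_
    (Eventually.of_forall fun n => prob_le_one)
  filter_upwards [hS] with n hn
  have hnull : NullMeasurableSet {ω | xi (H n ω) < t n} (P n) :=
    nullMeasurableSet_lt (aemeasurable_xi (hlaw n)) aemeasurable_const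
  rw [← prob_compl_eq_one_sub₀ hnull]
  refine measure_mono fun ω hω => hn ?_
  simpa using hω

end Asymptotic

end Hopfield

/-! ### Conclusion -/

theorem mainTheorem2 (α : ℝ) (hα : 0 < α)
    (m : ℕ → ℕ) (hm : Tendsto (fun n : ℕ => (m n : ℝ) / (n : ℝ)) atTop (𝓝 α))
    {Ω : ℕ → Type*} [∀ n, MeasurableSpace (Ω n)]
    (P : ∀ n, Measure (Ω n)) [∀ n, IsProbabilityMeasure (P n)]
    (H : ∀ n, Ω n → Matrix (Fin (m n)) (Fin n) ℝ)
    (hlaw : ∀ n i j, HasLaw (fun ω => H n ω i j) (gaussianReal 0 1) (P n))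
    (hindep : ∀ n, iIndepFun (fun (p : Fin (m n) × Fin n) ω => H n ω p.1 p.2) (P n)) :
    -- the minimum that defines the lower bound is attained
    IsLeast (Hopfield.objective α '' Set.Ici 0) (-Hopfield.xiLower α) ∧
    -- the bound on the expectation, for large n
    (∀ n, Integrable (fun ω => Hopfield.xi (H n ω)) (P n)) ∧
    (∀ ε : ℝ, 0 < ε → ∀ᶠ n : ℕ in atTop,
      Hopfield.xiLower α - ε ≤ (∫ ω, Hopfield.xi (H n ω) ∂(P n)) / Real.sqrt n) ∧
    -- the bounds in probability
    (∀ ε : ℝ, 0 < ε → Tendsto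
      (fun n : ℕ => P n {ω | Hopfield.xiLower α - ε ≤ Hopfield.xi (H n ω) / Real.sqrt n})
      atTop (𝓝 1)) ∧
    Tendsto (fun n : ℕ => P n {ω | Hopfield.xiLower α ≤ Hopfield.xi (H n ω)}) atTop (𝓝 1) ∧
    Tendsto (fun n : ℕ => P n {ω | Hopfield.xiLower α ^ 2 ≤ Hopfield.xi (H n ω) ^ 2})
      atTop (𝓝 1) ∧
    -- the square case
    (α = 1 → |Hopfield.xiLower α - 0.32016| < 0.000005 ∧
      ∀ᶠ n : ℕ in atTop, 0.32016 ≤ (∫ ω, Hopfield.xi (H n ω) ∂(P n)) / Real.sqrt n) := by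
  have hlow : Tendsto (fun n : ℕ => P n {ω | Hopfield.xiLower α ≤ Hopfield.xi (H n ω)})
      atTop (𝓝 1) ∧
      Tendsto (fun n : ℕ => P n {ω | Hopfield.xiLower α ^ 2 ≤ Hopfield.xi (H n ω) ^ 2})
      atTop (𝓝 1) := by
    have hpos := Hopfield.xiLower_pos hα
    -- These two limits compare ξₙ itself, not ξₙ/√n, with the constant. Since the constant is
    -- positive, half of it times √n already exceeds it for n ≥ 4, and any smaller positive fraction
    -- would also do.
    have ht := Hopfield.tendsto_measure_xi_lt hα hm hlaw hindep (half_pos hpos)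
    have hle : ∀ᶠ n : ℕ in atTop, Hopfield.xiLower α ≤
        (Hopfield.xiLower α - Hopfield.xiLower α / 2) * Real.sqrt n := by
      filter_upwards [eventually_ge_atTop 4] with n hn
      have h2 : (2 : ℝ) ≤ Real.sqrt n :=
        Real.le_sqrt_of_sq_le (by norm_num; exact_mod_cast hn)
      nlinarith
    constructor <;> refine Hopfield.tendsto_measure_one_of_subset hlaw ht ?_ <;>
      filter_upwards [hle] with n hn ω hω
    · exact hn.trans hω
    · exact pow_le_pow_left₀ hpos.le (hn.trans hω) 2
  refine ⟨Hopfield.isLeast_objective hα, fun n => Hopfield.integrable_xi (hlaw n),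
    fun ε hε => Hopfield.eventually_le_integral_xi hα hm hlaw hindep hε, fun ε hε => ?_,
    hlow.1, hlow.2, ?_⟩
  · refine Hopfield.tendsto_measure_one_of_subset hlaw
      (Hopfield.tendsto_measure_xi_lt hα hm hlaw hindep hε) ?_
    filter_upwards [eventually_gt_atTop 0] with n hn ω hω
    exact (le_div_iff₀ (Real.sqrt_pos.2 (by exact_mod_cast hn))).2 hω
  · rintro rfl
    obtain ⟨h1, h2⟩ := Hopfield.xiLower_one_bounds
    refine ⟨abs_lt.2 ⟨by linarith, by linarith⟩, ?_⟩
    -- The lower bound 0.3201601 on `xiLower 1` exceeds 0.32016 by exactly this ε.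
    filter_upwards [Hopfield.eventually_le_integral_xi hα hm hlaw hindep
      (by norm_num : (0 : ℝ) < 0.0000001)] with n hn
    linarith
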